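/- **Election model.** There are candidates $c_0,\dots,c_\ell$ and a finite directed network $(V,E,p)$ of voters with influence strengths $p:V\times V\to[0,1]$ (rational); every voter $v$ has a score function $\pi_v:\{c_0,\dots,c_\ell\}\to\mathbb N$, which is injective and otherwise arbitrary. A solution is a set $S\subseteq V$ of seeds with messages $m_s\in\mathbb Z^{\ell+1}$, $s\in S$; its cost is $|M|=\sum_{s\in S}\sum_i|m_s(i)|$. It has *single-news-article messages* if all seeds send the same message and this message is $+1$ or $-1$ on one candidate and $0$ on the others. In the random live graph $H\subseteq E$ every edge $e\in E$ is kept independently with probability $p(e)$. The message of $s$ activates $s$ at time $0$, and at time $t\ge 1$ it activates the voters not activated by it before that have an edge of $H$ from a voter activated by it at time $t-1$. If $R_v\subseteq S$ is the set of seeds whose message activates $v$ at some time, the score of $c_i$ for $v$ becomes $(1-\epsilon)\pi_v(i)+\sum_{s\in R_v}m_s(i)$ with $\epsilon=1/(1+\max_{v,i}\pi_v(i))$ (so ties are broken in favour of the candidate ranked last initially), and $v$ votes for the candidate with the highest score. $\mathsf{MoV}(S,M,H)$ is the number of votes of $c_0$ minus the maximum number of votes of another candidate. **ECS** (Election-Control-by-Seeding)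 *with single-news-article messages and two candidates*: given such a scenario with $\ell=1$ and a budget $B\in\mathbb N$, find $(S,M)$ with single-news-article messages and $|M|\le B$ that maximizes $\mathbb E_H[\mathsf{MoV}(S,M,H)-\mathsf{MoV}(\emptyset,\emptyset,H)]$. **DkS** (Densest-$k$-Subgraph): given a finite simple undirected graph $G=(X,N)$ and $k\le |X|$, find a set of exactly $k$ vertices that maximizes the number of edges of the subgraph it induces. A *$\rho$-approximation algorithm* for either problem is a polynomial-time algorithm (a Turing machine whose running time is polynomial in the length of the binary encoding of the instance) that returns, on every instance, a feasible solution whose value is at least $\rho$ times the value of every feasible solution. **Theorem.** For every real constant $\rho>0$: if there is a $\rho$-approximation algorithm for ECS with single-news-article messages, two candidates and arbitrary scores, then there is a $\rho$-approximation algorithm for DkS. Consequently, if DkS has no $\rho$-approximation algorithm for any constant $\rho>0$, then neither has ECS with single-news-article messages, two candidates and arbitrary scores. -/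

import Mathlib

namespace ElectionControl

/-! ### Elections on a social network -/

/-- An election scenario with candidates `c_0, …, c_ℓ` (`c_0` is the manipulator's candidate) and
voters `0, …, n - 1`. `E` is the set of directed edges and `p (u, v)` the strength of the influence
of `u` on `v`, a rational number so that a scenario is a finite object; `π v` assigns to the
candidates the pairwise distinct, otherwise arbitrary, scores of voter `v`. -/
structure Election (ℓ : ℕ) where
  n : ℕ
  E : Finset (Fin n × Fin n)
  p : Fin n × Fin n → ℚ
  p_nonneg : ∀ e, 0 ≤ p e
  p_le_one : ∀ e, p e ≤ 1
  π : Fin n → Fin (ℓ + 1) → ℕ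
  π_injective : ∀ v, Function.Injective (π v)

/-- A choice of seeds and messages among `n` voters: `P v = none` if `v` is not a seed, and
`P v = some m` if `v` is a seed with message `m`, where `m i` counts the news articles on `c_i`
sent by `v` (positive articles if `m i > 0`, negative ones if `m i < 0`). -/
abbrev SeedPlan (ℓ n : ℕ) : Type := Fin n → Option (Fin (ℓ + 1) → ℤ)

namespace SeedPlan

variable {ℓ n : ℕ}

/-- No seeds and no messages. -/
def empty : SeedPlan ℓ n := fun _ => none

/-- The information that `s` sends on `c_i`; it is `0` if `s` is not a seed. -/
def info (P : SeedPlan ℓ n) (s : Fin n) (i : Fin (ℓ + 1)) : ℤ :=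
  match P s with
  | none => 0
  | some m => m i

/-- The total number `|M|` of news articles sent by the seeds. -/
def cost (P : SeedPlan ℓ n) : ℕ := ∑ s, ∑ i, (P.info s i).natAbs

/-- Single-news-article messages: all seeds send the same message, which consists of one positive
or one negative news article on one candidate. -/
def IsSingleNews (P : SeedPlan ℓ n) : Prop :=
  ∃ (j : Fin (ℓ + 1)) (q : ℤ), (q = 1 ∨ q = -1) ∧ ∀ s m, P s = some m → m = Pi.single j q

end SeedPlan

/-- Diffusion in the live graph `H` of the message of the seed `s`. The first component at time `t`
is the set of voters that become active at time `t`, the second one is the set of voters that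
became active at some time `≤ t`. -/
def cascade {n : ℕ} (H : Finset (Fin n × Fin n)) (s : Fin n) :
    ℕ → Finset (Fin n) × Finset (Fin n)
  | 0 => ({s}, {s})
  | t + 1 =>
    let A : Finset (Fin n) := {v | v ∉ (cascade H s t).2 ∧ ∃ u ∈ (cascade H s t).1, (u, v) ∈ H}
    (A, (cascade H s t).2 ∪ A)

/-- In the live graph `H`, the voter `v` is activated by the message of `s` at some time. -/
def IsInfluenced {n : ℕ} (H : Finset (Fin n × Fin n)) (s v : Fin n) : Prop :=
  ∃ t, v ∈ (cascade H s t).1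

namespace Election

variable {ℓ : ℕ} (I : Election ℓ)

/-- The perturbation parameter of the tie-breaking rule, `1 / (1 + max_{v,i} π_v(i))`. -/
def ε : ℚ := 1 / (1 + ((Finset.univ.sup fun v => Finset.univ.sup (I.π v) : ℕ) : ℚ))

open Classical in
/-- The score that voter `v` gives to `c_i` after the diffusion and the preference revision.
The factor `1 - ε` breaks ties in favour of the candidate that was ranked last initially. -/
noncomputable def revisedScore (P : SeedPlan ℓ I.n) (H : Finset (Fin I.n × Fin I.n))
    (v : Fin I.n) (i : Fin (ℓ + 1)) : ℚ :=
  (1 - I.ε) * I.π v i + ∑ s with IsInfluenced H s v, (P.info s i : ℚ)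

open Classical in
/-- The voters that rank `c` first after the preference revision. -/
noncomputable def supporters (P : SeedPlan ℓ I.n) (H : Finset (Fin I.n × Fin I.n))
    (c : Fin (ℓ + 1)) : Finset (Fin I.n) :=
  {v | ∀ j, j ≠ c → I.revisedScore P H v j < I.revisedScore P H v c}

/-- The margin of victory of `c_0`. -/
noncomputable def MoV (P : SeedPlan ℓ I.n) (H : Finset (Fin I.n × Fin I.n)) : ℤ :=
  ((I.supporters P H 0).card : ℤ) -
    (((Finset.univ.filter (· ≠ 0)).sup fun c => (I.supporters P H c).card : ℕ) : ℤ)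

/-- The probability that the live graph is `H`: every edge `e` of the network is kept with
probability `p e`, independently. -/
def liveProb (H : Finset (Fin I.n × Fin I.n)) : ℚ :=
  ∏ e ∈ I.E, if e ∈ H then I.p e else 1 - I.p e

/-- The expected increase of the margin of victory of `c_0` caused by the seeds. -/
noncomputable def expectedGain (P : SeedPlan ℓ I.n) : ℚ :=
  ∑ H ∈ I.E.powerset, I.liveProb H * ((I.MoV P H - I.MoV SeedPlan.empty H : ℤ) : ℚ)

end Election

/-! ### The two optimization problems -/

/-- An instance of Election-Control-by-Seeding: an election scenario and a budget. -/
structure ECSInstance (ℓ : ℕ) extends Election ℓ where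
  B : ℕ

/-- Feasible solutions of an ECS instance in the setting with single-news-article messages. -/
def ECSInstance.Feasible {ℓ : ℕ} (I : ECSInstance ℓ) (P : SeedPlan ℓ I.n) : Prop :=
  P.IsSingleNews ∧ P.cost ≤ I.B

/-- An instance of Densest-`k`-Subgraph. -/
structure DkSInstance where
  n : ℕ
  G : SimpleGraph (Fin n)
  k : ℕ
  k_le : k ≤ n

/-- The number of edges of the subgraph induced by `X`. -/
noncomputable def DkSInstance.density (I : DkSInstance) (X : Finset (Fin I.n)) : ℕ :=
  (I.G.induce (X : Set (Fin I.n))).edgeSet.ncard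

/-! ### Encodings as strings over the alphabet `{0, 1, #}` (where `none` is the separator `#`) -/

/-- A list of natural numbers is written in binary, each number followed by a separator. -/
def encodeNats (l : List ℕ) : List (Option Bool) :=
  l.flatMap fun a => (Computability.encodeNat a).map some ++ [none]

/-- The number of voters, the budget, for each pair of voters whether it is an edge together with
the numerator and the denominator of its strength, and the scores. -/
def encodeECSInstance {ℓ : ℕ} (I : ECSInstance ℓ) : List (Option Bool) :=
  encodeNats <|
    [I.n, I.B] ++
    ((List.finRange I.n).flatMap fun u => (List.finRange I.n).flatMap fun v =>
      [if (u, v) ∈ I.E then 1 else 0, (I.p (u, v)).num.toNat, (I.p (u, v)).den]) ++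
    ((List.finRange I.n).flatMap fun v => (List.finRange (ℓ + 1)).map fun i => I.π v i)

/-- The number of voters and, for each voter, `0` if it is not a seed, and otherwise `1` followed
by its message (an integer is coded by a natural number: `m ≥ 0` by `2 m`, and `m < 0` by
`-2 m - 1`). -/
def encodeSeedPlan {ℓ : ℕ} (x : Σ n, SeedPlan ℓ n) : List (Option Bool) :=
  encodeNats <|
    x.1 :: (List.finRange x.1).flatMap fun s =>
      match x.2 s with
      | none => [0]
      | some m => 1 :: (List.finRange (ℓ + 1)).map fun i => Equiv.intEquivNat (m i)

open Classical in
/-- The number of vertices, the number `k` and the adjacency matrix. -/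
noncomputable def encodeDkSInstance (I : DkSInstance) : List (Option Bool) :=
  encodeNats <|
    [I.n, I.k] ++
    ((List.finRange I.n).flatMap fun u => (List.finRange I.n).map fun v =>
      if I.G.Adj u v then 1 else 0)

/-- The number of vertices and the characteristic vector of the set. -/
def encodeVertexSet (x : Σ n, Finset (Fin n)) : List (Option Bool) :=
  encodeNats <| x.1 :: (List.finRange x.1).map fun v => if v ∈ x.2 then 1 else 0

/-! ### Polynomial-time approximation algorithms -/

/-- There is a polynomial-time `ρ`-approximation algorithm for ECS with single-news-article
messages and `ℓ + 1` candidates (and arbitrary scores). -/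
def ECSSingleNewsApproximable (ℓ : ℕ) (ρ : ℝ) : Prop :=
  ∃ A : (I : ECSInstance ℓ) → SeedPlan ℓ I.n,
    (∀ I : ECSInstance ℓ, I.Feasible (A I) ∧
      ∀ P : SeedPlan ℓ I.n, I.Feasible P → ρ * (I.expectedGain P : ℝ) ≤ (I.expectedGain (A I) : ℝ)) ∧
    Nonempty (Turing.TM2ComputableInPolyTime encodeECSInstance encodeSeedPlan
      fun I : ECSInstance ℓ => (⟨I.n, A I⟩ : Σ n, SeedPlan ℓ n))

/-- There is a polynomial-time `ρ`-approximation algorithm for Densest-`k`-Subgraph. -/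
def DkSApproximable (ρ : ℝ) : Prop :=
  ∃ A : (I : DkSInstance) → Finset (Fin I.n),
    (∀ I : DkSInstance, (A I).card = I.k ∧
      ∀ X : Finset (Fin I.n), X.card = I.k → ρ * (I.density X : ℝ) ≤ (I.density (A I) : ℝ)) ∧
    Nonempty (Turing.TM2ComputableInPolyTime encodeDkSInstance encodeVertexSet
      fun I : DkSInstance => (⟨I.n, A I⟩ : Σ n, Finset (Fin n)))

end ElectionControl

/-!
The election on the pairs of vertices in which the pair `(a, a)` influences all pairs that contain
`a`, and in which a voter prefers `c_1` to `c_0` by two points if it is an edge of the graph and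
prefers `c_0` otherwise, turns densest subgraphs into margins of victory. Two seeds must reach an
edge to win it for `c_0`, and only the seeds `(a, a)`, `(b, b)` and `(a, b)` reach `(a, b)`; so a
plan with `k` seeds wins only edges inside a set of at most `k` vertices that can be read off the
plan, and seeding `(a, a)` for each `a` in a set of `k` vertices wins all the edges inside this set.
Each edge is counted twice, as `(a, b)` and as `(b, a)`, and each won vote changes the margin by
two, so gains are four times the numbers of edges and the approximation ratio is preserved.

The polynomial-time algorithm is written in a small language of structured stack programs with one
call to an external machine; it is compiled once and for all to a Turing machine.
-/

namespace StackProgram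

open Turing Function StateTransition

/-! ### Runs with a bound on the number of steps -/

section Runs

variable {σ τ : Type*} {f : σ → Option σ} {g : τ → Option τ} {m n : ℕ} {a b c : σ}

/-- `f` leads from `a` to `b` in at most `n` steps. This is the proposition behind the data
`EvalsToInTime`, so that it can be proved by induction on propositions. -/
def ReachesIn (f : σ → Option σ) (n : ℕ) (a b : σ) : Prop :=
  Nonempty (EvalsToInTime f a (some b) n)

theorem ReachesIn.single (h : f a = some b) : ReachesIn f 1 a b := ⟨⟨⟨1, h⟩, le_rfl⟩⟩

theorem ReachesIn.mono (h : ReachesIn f m a b) (hmn : m ≤ n) : ReachesIn f n a b :=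
  h.map fun e => ⟨e.toEvalsTo, e.steps_le_m.trans hmn⟩

theorem ReachesIn.trans (h : ReachesIn f m a b) (h' : ReachesIn f n b c) :
    ReachesIn f (m + n) a c := by
  obtain ⟨e⟩ := h
  obtain ⟨e'⟩ := h'
  exact add_comm m n ▸ ⟨EvalsToInTime.trans f m n a b (some c) e e'⟩

theorem ReachesIn.head (h : f a = some b) (h' : ReachesIn f n b c) : ReachesIn f (n + 1) a c :=
  add_comm n 1 ▸ (ReachesIn.single h).trans h'

theorem ReachesIn.map (φ : σ → τ) (hφ : ∀ a b, f a = some b → g (φ a) = some (φ b))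
    (h : ReachesIn f n a b) : ReachesIn g n (φ a) (φ b) := by
  have key : ∀ k b, (flip bind f)^[k] (some a) = some b →
      (flip bind g)^[k] (some (φ a)) = some (φ b) := by
    intro k
    induction k with
    | zero => rintro b ⟨⟩; rfl
    | succ k ih =>
      intro b hb
      rw [iterate_succ_apply'] at hb ⊢
      obtain ⟨c, hc, hcb⟩ := Option.bind_eq_some_iff.mp hb
      rw [ih c hc]
      exact hφ c b hcb
  obtain ⟨⟨k, hk⟩, hkn⟩ := h
  exact ⟨⟨⟨k, key k b hk⟩, hkn⟩⟩

end Runs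

/-! ### Structured programs over stacks -/

/-- Structured programs over stacks with indices in `K` and symbols in `Γ`. `branch` looks at the
top symbol of a stack, `loop` pops symbols from a stack until it is empty, and runs its body after
each of them. `call i o` runs an external machine. -/
inductive Prog (K Γ : Type) : Type
  | skip : Prog K Γ
  | push (k : K) (a : Γ) : Prog K Γ
  | pop (k : K) : Prog K Γ
  | seq (p q : Prog K Γ) : Prog K Γ
  | branch (k : K) (b : Option Γ → Prog K Γ) : Prog K Γ
  | loop (k : K) (b : Γ → Prog K Γ) : Prog K Γ
  | call (i o : K) : Prog K Γ

infixr:60 " ;; " => Prog.seq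

section Semantics

variable {K Γ : Type} [DecidableEq K] {R : List Γ → List Γ → ℕ → Prop}

/-- `Exec R p s s' t`: the program `p` leads from the stacks `s` to the stacks `s'` in time at most
`t`, if the external machine turns `x` into `y` in time `t'` whenever `R x y t'`. The call reads its
input from the bottom of a stack to the top, and pushes its output from the first symbol on. -/
inductive Exec (R : List Γ → List Γ → ℕ → Prop) :
    Prog K Γ → (K → List Γ) → (K → List Γ) → ℕ → Prop
  | skip {s} : Exec R .skip s s 1
  | push {k a s} : Exec R (.push k a) s (update s k (a :: s k)) 1
  | pop {k s} : Exec R (.pop k) s (update s k (s k).tail) 1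
  | seq {p q s s' s'' t t'} : Exec R p s s' t → Exec R q s' s'' t' →
      Exec R (.seq p q) s s'' (t + t')
  | branch {k b s s' t} : Exec R (b (s k).head?) s s' t → Exec R (.branch k b) s s' (t + 1)
  | loop_nil {k b s} : s k = [] → Exec R (.loop k b) s s 1
  | loop_cons {k b s s' s'' x xs t t'} : s k = x :: xs → Exec R (b x) (update s k xs) s' t →
      Exec R (.loop k b) s' s'' t' → Exec R (.loop k b) s s'' (t + t' + 1)
  | call {i o s x y t} : R x y t → s i = x.reverse →
      Exec R (.call i o) s (update (update s i []) o (y.reverse ++ update s i [] o))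
        (x.length + t + y.length + 2)
  | mono {p s s' t t'} : Exec R p s s' t → t ≤ t' → Exec R p s s' t'

theorem Exec.of_eq {p : Prog K Γ} {s s' s'' : K → List Γ} {t t' : ℕ} (h : Exec R p s s' t)
    (hs : s' = s'') (ht : t ≤ t') : Exec R p s s'' t' :=
  hs ▸ h.mono ht

theorem Exec.of_start_eq {p : Prog K Γ} {s s' s'' : K → List Γ} {t : ℕ} (h : Exec R p s s' t)
    (hs : s'' = s) : Exec R p s'' s' t :=
  hs ▸ h

end Semantics

/-! ### Compilation to Turing machines -/

section Compile

variable {K Γ : Type} (M : FinTM2)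

/-- The labels of the compiled program. -/
inductive Label : Prog K Γ → Type
  | skip : Label .skip
  | push {k a} : Label (.push k a)
  | pop {k} : Label (.pop k)
  | seqLeft {p q} (l : Label p) : Label (.seq p q)
  | seqRight {p q} (l : Label q) : Label (.seq p q)
  | branchHead {k b} : Label (.branch k b)
  | branchBody {k b} (o : Option Γ) (l : Label (b o)) : Label (.branch k b)
  | loopHead {k b} : Label (.loop k b)
  | loopBody {k b} (x : Γ) (l : Label (b x)) : Label (.loop k b)
  | callLoad {i o} : Label (.call i o)
  | callRun {i o} (l : M.Λ) : Label (.call i o)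
  | callUnload {i o} : Label (.call i o)

instance finite_label [Finite Γ] (p : Prog K Γ) : Finite (Label M p) := by
  induction p with
  | skip => exact Finite.of_surjective (fun _ : Unit => .skip) fun l => by cases l; simp
  | push => exact Finite.of_surjective (fun _ : Unit => .push) fun l => by cases l; simp
  | pop => exact Finite.of_surjective (fun _ : Unit => .pop) fun l => by cases l; simp
  | seq p q hp hq =>
    refine Finite.of_surjective (Sum.elim .seqLeft .seqRight) fun l => ?_
    cases l <;> simp
  | branch k b h =>
    refine Finite.of_surjective (fun x : Option (Σ o, Label M (b o)) =>
      x.elim .branchHead fun y => .branchBody y.1 y.2) fun l => ?_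
    cases l with
    | branchHead => exact ⟨none, rfl⟩
    | branchBody o l => exact ⟨some ⟨o, l⟩, rfl⟩
  | loop k b h =>
    refine Finite.of_surjective (fun x : Option (Σ o, Label M (b o)) =>
      x.elim .loopHead fun y => .loopBody y.1 y.2) fun l => ?_
    cases l with
    | loopHead => exact ⟨none, rfl⟩
    | loopBody o l => exact ⟨some ⟨o, l⟩, rfl⟩
  | call =>
    have := M.ΛFin
    refine Finite.of_surjective (fun x : Option (Option M.Λ) =>
      x.elim .callLoad fun y => y.elim .callUnload .callRun) fun l => ?_
    cases l with
    | callLoad => exact ⟨none, rfl⟩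
    | callUnload => exact ⟨some none, rfl⟩
    | callRun l => exact ⟨some (some l), rfl⟩

/-- The label at which the execution of a program starts. -/
def start : (p : Prog K Γ) → Label M p
  | .skip => .skip
  | .push _ _ => .push
  | .pop _ => .pop
  | .seq p _ => .seqLeft (start p)
  | .branch _ _ => .branchHead
  | .loop _ _ => .loopHead
  | .call _ _ => .callLoad

variable (K Γ) in
/-- The alphabets of the stacks of the compiled program: those of the program and those of the
external machine. -/
abbrev Alphabet : K ⊕ M.K → Type
  | Sum.inl _ => Γ
  | Sum.inr k => M.Γ k

variable (Γ) in
/-- The internal states of the compiled program: the symbol read last and the state of the external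
machine. -/
abbrev Register : Type := Option Γ × M.σ

/-- A statement of the external machine, executed on its part of the memory. Instead of halting,
it jumps to the label `exit`. -/
def liftStmt {Λ : Type} (emb : M.Λ → Λ) (exit : Λ) :
    TM2.Stmt M.Γ M.Λ M.σ → TM2.Stmt (Alphabet K Γ M) Λ (Register Γ M)
  | .push k f q => .push (Sum.inr k) (fun v => f v.2) (liftStmt emb exit q)
  | .peek k f q => .peek (Sum.inr k) (fun v o => (v.1, f v.2 o)) (liftStmt emb exit q)
  | .pop k f q => .pop (Sum.inr k) (fun v o => (v.1, f v.2 o)) (liftStmt emb exit q)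
  | .load f q => .load (fun v => (v.1, f v.2)) (liftStmt emb exit q)
  | .branch f q q' => .branch (fun v => f v.2) (liftStmt emb exit q) (liftStmt emb exit q')
  | .goto f => .goto fun v => emb (f v.2)
  | .halt => .goto fun _ => exit

/-- The stacks of the compiled program, from those of the program and of the external machine. -/
def join (s : K → List Γ) (S : ∀ k, List (M.Γ k)) : ∀ k, List (Alphabet K Γ M k)
  | Sum.inl k => s k
  | Sum.inr k => S k

@[simp] theorem join_inl (s : K → List Γ) (S : ∀ k, List (M.Γ k)) (k : K) :
    join M s S (Sum.inl k) = s k := rfl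

@[simp] theorem join_inr (s : K → List Γ) (S : ∀ k, List (M.Γ k)) (k : M.K) :
    join M s S (Sum.inr k) = S k := rfl

theorem join_eq_rec (s : K → List Γ) (S : ∀ k, List (M.Γ k)) :
    join M s S = Sum.rec s S := by
  funext k
  cases k <;> rfl

theorem join_nil : join M (fun _ : K => ([] : List Γ)) (fun _ => []) = fun _ => [] := by
  funext k
  cases k <;> rfl

variable [DecidableEq K]

@[simp] theorem update_join_inl (s : K → List Γ) (S : ∀ k, List (M.Γ k)) (k : K) (x : List Γ) :
    update (join M s S) (Sum.inl k) x = join M (update s k x) S := by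
  simp only [join_eq_rec]
  exact (Sum.rec_update_left (γ := fun k => List (Alphabet K Γ M k)) s S k x).symm

@[simp] theorem update_join_inr (s : K → List Γ) (S : ∀ k, List (M.Γ k)) (k : M.K)
    (x : List (M.Γ k)) :
    update (join M s S) (Sum.inr k) x = join M s (update S k x) := by
  simp only [join_eq_rec]
  exact (Sum.rec_update_right (γ := fun k => List (Alphabet K Γ M k)) s S k x).symm

/-- The configuration of the compiled program that corresponds to one of the external machine. -/
def liftCfg {Λ : Type} (emb : M.Λ → Λ) (exit : Λ) (r : Option Γ) (s : K → List Γ) (c : M.Cfg) :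
    TM2.Cfg (Alphabet K Γ M) Λ (Register Γ M) :=
  ⟨some (c.l.elim exit emb), (r, c.var), join M s c.stk⟩

theorem stepAux_liftStmt {Λ : Type} (emb : M.Λ → Λ) (exit : Λ) (r : Option Γ) (s : K → List Γ)
    (q : TM2.Stmt M.Γ M.Λ M.σ) (v : M.σ) (S : ∀ k, List (M.Γ k)) :
    TM2.stepAux (liftStmt M emb exit q) (r, v) (join M s S) =
      liftCfg M emb exit r s (TM2.stepAux q v S) := by
  induction q generalizing v S with
  | push k f q ih =>
    simp only [liftStmt, TM2.stepAux]
    rw [← ih]; congr 1; exact update_join_inr M s S k _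
  | peek k f q ih => simp only [liftStmt, TM2.stepAux, join_inr]; exact ih _ _
  | pop k f q ih =>
    simp only [liftStmt, TM2.stepAux]
    rw [← ih]; congr 1; exact update_join_inr M s S k _
  | load f q ih => simp only [liftStmt, TM2.stepAux]; exact ih _ _
  | branch f q q' ih ih' =>
    simp only [liftStmt, TM2.stepAux]
    cases f v
    · exact ih' _ _
    · exact ih _ _
  | goto f => rfl
  | halt => rfl

theorem step_liftCfg {Λ : Type} {m : Λ → TM2.Stmt (Alphabet K Γ M) Λ (Register Γ M)}
    {emb : M.Λ → Λ} {exit : Λ} (hm : ∀ l, m (emb l) = liftStmt M emb exit (M.m l)) (r : Option Γ)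
    (s : K → List Γ) (c c' : M.Cfg) (h : M.step c = some c') :
    TM2.step m (liftCfg M emb exit r s c) = some (liftCfg M emb exit r s c') := by
  obtain ⟨_ | l, v, S⟩ := c
  · cases h
  · obtain rfl : TM2.stepAux (M.m l) v S = c' := Option.some_injective _ h
    change some (TM2.stepAux (m (emb l)) (r, v) (join M s S)) = _
    rw [hm, stepAux_liftStmt]

theorem initList_stk (tm : FinTM2) (l : List (tm.Γ tm.k₀)) :
    (initList tm l).stk = update (fun _ => []) tm.k₀ l := by
  funext k
  by_cases h : k = tm.k₀
  · subst h; simp [initList]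
  · simp [initList, h]

theorem haltList_stk (tm : FinTM2) (l : List (tm.Γ tm.k₁)) :
    (haltList tm l).stk = update (fun _ => []) tm.k₁ l := by
  funext k
  by_cases h : k = tm.k₁
  · subst h; simp [haltList]
  · simp [haltList, h]

variable [Inhabited Γ] (ein : M.Γ M.k₀ ≃ Γ) (eout : M.Γ M.k₁ ≃ Γ)

/-- The statements of the compiled program, for an embedding `emb` of its labels into the labels
of the whole machine and a label `exit` at which the execution goes on afterwards. The bijections
`ein` and `eout` translate the input and output alphabets of the external machine. -/
def code : (p : Prog K Γ) → {Λ : Type} → (Label M p → Λ) → Λ → Label M p →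
    TM2.Stmt (Alphabet K Γ M) Λ (Register Γ M)
  | .skip, _, _, exit, _ => .goto fun _ => exit
  | .push k a, _, _, exit, _ => .push (Sum.inl k) (fun _ => a) <| .goto fun _ => exit
  | .pop k, _, _, exit, _ => .pop (Sum.inl k) (fun v _ => v) <| .goto fun _ => exit
  | .seq p q, _, emb, _, .seqLeft l =>
    code p (fun l => emb (.seqLeft l)) (emb (.seqRight (start M q))) l
  | .seq _ q, _, emb, exit, .seqRight l => code q (fun l => emb (.seqRight l)) exit l
  | .branch k b, _, emb, _, .branchHead =>
    .peek (Sum.inl k) (fun v o => (o, v.2)) <|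
      .goto fun v => emb (.branchBody v.1 (start M (b v.1)))
  | .branch _ b, _, emb, exit, .branchBody o l =>
    code (b o) (fun l => emb (.branchBody o l)) exit l
  | .loop k b, _, emb, exit, .loopHead =>
    .pop (Sum.inl k) (fun v o => (o, v.2)) <| .goto fun v =>
      v.1.elim exit fun x => emb (.loopBody x (start M (b x)))
  | .loop _ b, _, emb, _, .loopBody x l =>
    code (b x) (fun l => emb (.loopBody x l)) (emb .loopHead) l
  | .call i _, _, emb, _, .callLoad =>
    .pop (Sum.inl i) (fun v o => (o, v.2)) <| .branch (fun v => v.1.isSome)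
      (.push (Sum.inr M.k₀) (fun v => ein.symm (v.1.getD default)) <|
        .goto fun _ => emb .callLoad)
      (.goto fun _ => emb (.callRun M.main))
  | .call _ o, _, emb, exit, .callUnload =>
    .pop (Sum.inr M.k₁) (fun v x => (x.map eout, v.2)) <| .branch (fun v => v.1.isSome)
      (.push (Sum.inl o) (fun v => v.1.getD default) <| .goto fun _ => emb .callUnload)
      (.goto fun _ => exit)
  | .call _ _, _, emb, _, .callRun l =>
    liftStmt M (fun l => emb (.callRun l)) (emb .callUnload) (M.m l)

/-! ### Correctness of the compilation -/

/-- The external machine turns `x` into `y` in time at most `t`. -/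
def Outputs (x y : List Γ) (t : ℕ) : Prop :=
  Nonempty (TM2OutputsInTime M (x.map ein.symm) (some (y.map eout.symm)) t)

/-- A configuration of the compiled program between two executions of the external machine. -/
def idle {Λ : Type} (l : Option Λ) (r : Option Γ) (s : K → List Γ) :
    TM2.Cfg (Alphabet K Γ M) Λ (Register Γ M) :=
  ⟨l, (r, M.initialState), join M s fun _ => []⟩

variable {M}

section Call

variable {Λ : Type} {m : Λ → TM2.Stmt (Alphabet K Γ M) Λ (Register Γ M)} {i o : K}
  {emb : Label M (.call i o : Prog K Γ) → Λ} {exit : Λ}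

theorem reachesIn_callLoad (hm : ∀ l, m (emb l) = code M ein eout _ emb exit l)
    (r : Option Γ) (s : K → List Γ) (x : List Γ) (w : List (M.Γ M.k₀)) (hx : s i = x) :
    ReachesIn (TM2.step m) (x.length + 1)
      ⟨some (emb .callLoad), (r, M.initialState), join M s (update (fun _ => []) M.k₀ w)⟩
      ⟨some (emb (.callRun M.main)), (none, M.initialState),
        join M (update s i []) (update (fun _ => []) M.k₀ (x.reverse.map ein.symm ++ w))⟩ := by
  induction x generalizing r s w with
  | nil =>
    refine ReachesIn.single ?_
    simp [TM2.step, hm, code, hx]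
  | cons a x ih =>
    have h := ih (some a) (update s i x) (ein.symm a :: w) (by simp)
    refine ReachesIn.head ?_ (by simpa using h)
    simp [TM2.step, hm, code, hx]

theorem reachesIn_callUnload (hm : ∀ l, m (emb l) = code M ein eout _ emb exit l)
    (r : Option Γ) (s : K → List Γ) (y : List Γ) :
    ReachesIn (TM2.step m) (y.length + 1)
      ⟨some (emb .callUnload), (r, M.initialState),
        join M s (update (fun _ => []) M.k₁ (y.map eout.symm))⟩
      (idle M (some exit) none (update s o (y.reverse ++ s o))) := by
  induction y generalizing r s with
  | nil =>
    refine ReachesIn.single ?_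
    simp [TM2.step, hm, code, idle]
  | cons a y ih =>
    have h := ih (some a) (update s o (a :: s o))
    refine ReachesIn.head ?_ (by simpa using h)
    simp [TM2.step, hm, code]

variable {ein eout}

theorem reachesIn_call (hm : ∀ l, m (emb l) = code M ein eout _ emb exit l)
    {x y : List Γ} {t : ℕ} (h : Outputs M ein eout x y t) (r : Option Γ) {s : K → List Γ}
    (hx : s i = x.reverse) :
    ReachesIn (TM2.step m) (x.length + t + y.length + 2) (idle M (some (emb .callLoad)) r s)
      (idle M (some exit) none (update (update s i []) o (y.reverse ++ update s i [] o))) := by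
  have load := reachesIn_callLoad ein eout hm r s x.reverse [] hx
  have run := ReachesIn.map (g := TM2.step m) _
    (step_liftCfg M (emb := fun l => emb (.callRun l)) (fun l => by rw [hm]; rfl) none
      (update s i [])) h
  have unload := reachesIn_callUnload ein eout hm none (update s i []) y
  rw [liftCfg, liftCfg, initList_stk, haltList_stk] at run
  refine (ReachesIn.trans (ReachesIn.trans ?_ run) unload).mono
    (m := (x.length + 1) + t + (y.length + 1)) (by omega)
  simpa [idle, initList] using load

end Call

variable {ein eout}

theorem Exec.reachesIn {p : Prog K Γ} {s s' : K → List Γ} {t : ℕ}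
    (h : Exec (Outputs M ein eout) p s s' t) {Λ : Type}
    {m : Λ → TM2.Stmt (Alphabet K Γ M) Λ (Register Γ M)} {emb : Label M p → Λ} {exit : Λ}
    (hm : ∀ l, m (emb l) = code M ein eout _ emb exit l) (r : Option Γ) :
    ∃ r', ReachesIn (TM2.step m) t (idle M (some (emb (start M p))) r s)
      (idle M (some exit) r' s') := by
  induction h generalizing exit r with
  | skip => exact ⟨r, .single (by simp [idle, TM2.step, hm, code, start])⟩
  | push => exact ⟨r, .single (by simp [idle, TM2.step, hm, code, start])⟩
  | pop => exact ⟨r, .single (by simp [idle, TM2.step, hm, code, start])⟩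
  | @seq p q s s' s'' t t' _ _ ih ih' =>
    obtain ⟨r₁, h₁⟩ := ih (emb := fun l => emb (.seqLeft l))
      (exit := emb (.seqRight (start M q))) (fun l => by rw [hm]; rfl) r
    obtain ⟨r₂, h₂⟩ := ih' (emb := fun l => emb (.seqRight l)) (exit := exit)
      (fun l => by rw [hm]; rfl) r₁
    exact ⟨r₂, h₁.trans h₂⟩
  | @branch k b s s' t _ ih =>
    obtain ⟨r₁, h₁⟩ := ih (emb := fun l => emb (.branchBody (s k).head? l)) (exit := exit)
      (fun l => by rw [hm]; rfl) (s k).head?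
    refine ⟨r₁, h₁.head ?_⟩
    simp [idle, TM2.step, hm, code, start]
  | @loop_nil k b s hs =>
    refine ⟨none, .single ?_⟩
    have : update s k [] = s := by rw [← hs, update_eq_self]
    simp [idle, TM2.step, hm, code, start, hs, this]
  | @loop_cons k b s s' s'' x xs t t' hs _ _ ih ih' =>
    obtain ⟨r₁, h₁⟩ := ih (emb := fun l => emb (.loopBody x l)) (exit := emb .loopHead)
      (fun l => by rw [hm]; rfl) (some x)
    obtain ⟨r₂, h₂⟩ := ih' hm r₁
    refine ⟨r₂, (h₁.trans h₂).head ?_⟩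
    simp [idle, TM2.step, hm, code, start, hs]
  | call hR hx => exact ⟨none, reachesIn_call hm hR r hx⟩
  | mono _ hle ih => exact (ih hm r).imp fun _ H => H.mono hle

variable (M ein eout) in
/-- The Turing machine that runs a program, with input stack `i` and output stack `o`, and then
halts. -/
noncomputable def machine [Fintype K] [Fintype Γ] (p : Prog K Γ) (i o : K) : FinTM2 where
  K := K ⊕ M.K
  kDecidableEq := inferInstance
  kFin := haveI := M.kFin; inferInstance
  k₀ := Sum.inl i
  k₁ := Sum.inl o
  Γ := Alphabet K Γ M
  Λ := Option (Label M p)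
  main := some (start M p)
  ΛFin := Fintype.ofFinite _
  σ := Register Γ M
  initialState := (none, M.initialState)
  σFin := haveI := M.σFin; inferInstance
  Γk₀Fin := inferInstanceAs (Fintype Γ)
  m l := l.elim (.load (fun _ => (none, M.initialState)) .halt) (code M ein eout p some none)

variable [Fintype K] [Fintype Γ] (p : Prog K Γ) (i o : K)

theorem initList_machine (x : List Γ) :
    initList (machine M ein eout p i o) x =
      idle M (some (some (start M p))) none (update (fun _ => []) i x) := by
  have : (initList (machine M ein eout p i o) x).stk =
      join M (update (fun _ => []) i x) fun _ => [] := by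
    rw [← update_join_inl, join_nil]
    exact initList_stk (machine M ein eout p i o) x
  rw [idle, ← this]
  rfl

theorem haltList_machine (y : List Γ) :
    haltList (machine M ein eout p i o) y = idle M none none (update (fun _ => []) o y) := by
  have : (haltList (machine M ein eout p i o) y).stk =
      join M (update (fun _ => []) o y) fun _ => [] := by
    rw [← update_join_inl, join_nil]
    exact haltList_stk (machine M ein eout p i o) y
  rw [idle, ← this]
  rfl

variable {p i o}

theorem Exec.machine_outputs {x y : List Γ} {t : ℕ}
    (h : Exec (Outputs M ein eout) p (update (fun _ => []) i x) (update (fun _ => []) o y) t) :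
    Nonempty (TM2OutputsInTime (machine M ein eout p i o) x (some y) (t + 1)) := by
  obtain ⟨r, run⟩ := h.reachesIn (m := (machine M ein eout p i o).m) (emb := some)
    (exit := none) (fun _ => rfl) none
  have halt : ReachesIn (machine M ein eout p i o).step 1
      (idle M (some none) r (update (fun _ => []) o y))
      (idle M none none (update (fun _ => []) o y)) := .single rfl
  change ReachesIn (machine M ein eout p i o).step (t + 1) (initList _ x) (haltList _ y)
  rw [initList_machine, haltList_machine]
  exact run.trans halt

end Compile

end StackProgram

namespace StackProgram

open Function

/-! ### Basic programs -/

section Basic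

variable {K Γ : Type} [DecidableEq K] {R : List Γ → List Γ → ℕ → Prop}

/-- Moves the content of the stack `a` to the stack `b`; its order is reversed. -/
def move (a b : K) : Prog K Γ := .loop a fun x => .push b x

/-- Empties a stack. -/
def clear (a : K) : Prog K Γ := .loop a fun _ => .skip

/-- Pushes the symbols of a string. -/
def pushAll (o : K) : List Γ → Prog K Γ
  | [] => .skip
  | a :: w => .push o a ;; pushAll o w

/-- Runs `body` on the symbols of the stack `k`, from top to bottom. The stack `t` keeps the symbols
meanwhile, and `k` is restored in the end. -/
def each (k t : K) (body : Γ → Prog K Γ) : Prog K Γ :=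
  .loop k (fun x => .push t x ;; body x) ;; move t k

/-- Replaces the content `x` of the stack `k` by `a :: x.dropLast`. -/
def shift (a : Γ) (k t : K) : Prog K Γ := move k t ;; .pop t ;; move t k ;; .push k a

/-- The loop invariant `S l₁ l₂` describes the stacks after the items of `l₁` have been processed
and when those of `l₂` remain. -/
theorem exec_loop {k : K} {ι : Type*} {body : Γ → Prog K Γ} {C : ℕ} {l : List ι}
    {S : List ι → List ι → K → List Γ} (hnil : S l [] k = [])
    (hbody : ∀ l₁ i l₂, l = l₁ ++ i :: l₂ → ∃ x xs, S l₁ (i :: l₂) k = x :: xs ∧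
      Exec R (body x) (update (S l₁ (i :: l₂)) k xs) (S (l₁ ++ [i]) l₂) C) :
    Exec R (.loop k body) (S [] l) (S l []) (l.length * (C + 1) + 1) := by
  suffices ∀ l₁ l₂, l = l₁ ++ l₂ →
      Exec R (.loop k body) (S l₁ l₂) (S l []) (l₂.length * (C + 1) + 1) from this [] l rfl
  intro l₁ l₂ hl
  induction l₂ generalizing l₁ with
  | nil =>
    obtain rfl : l = l₁ := by simpa using hl
    exact (Exec.loop_nil hnil).mono (by simp)
  | cons i l₂ ih =>
    obtain ⟨x, xs, hk, first⟩ := hbody l₁ i l₂ hl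
    exact (Exec.loop_cons hk first (ih (l₁ ++ [i]) (by simpa using hl))).mono
      (by simp only [List.length_cons]; ring_nf; omega)

theorem exec_move {a b : K} (hab : a ≠ b) {x : List Γ} {s : K → List Γ} (hx : s a = x) :
    Exec R (move a b) s (update (update s a []) b (x.reverse ++ s b)) (2 * x.length + 1) := by
  have loop := exec_loop (R := R) (k := a) (l := x) (C := 1) (body := .push b)
    (S := fun l₁ l₂ => update (update s a l₂) b (l₁.reverse ++ s b)) (by simp [hab])
    fun l₁ c l₂ _ => ⟨c, l₂, by simp [hab], Exec.push.of_eq (by grind [update_apply]) le_rfl⟩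
  exact (loop.of_start_eq (by simp [← hx])).mono (by omega)

theorem exec_clear {a : K} {s : K → List Γ} {x : List Γ} (hx : s a = x) :
    Exec R (clear a) s (update s a []) (2 * x.length + 1) := by
  have loop := exec_loop (R := R) (k := a) (l := x) (C := 1) (body := fun _ => .skip)
    (S := fun _ l₂ => update s a l₂) (by simp)
    fun l₁ c l₂ _ => ⟨c, l₂, by simp, Exec.skip.of_eq (by simp) le_rfl⟩
  exact (loop.of_start_eq (by simp [← hx])).mono (by omega)

theorem exec_shift {a : Γ} {k t : K} (hkt : k ≠ t) {s : K → List Γ} {x : List Γ} (hk : s k = x)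
    (ht : s t = []) :
    Exec R (shift a k t) s (update s k (a :: x.dropLast)) (4 * x.length + 4) := by
  have h₁ := exec_move (R := R) hkt hk
  have h₂ := exec_move (R := R) hkt.symm (x := x.reverse.tail)
    (s := update (update s k []) t x.reverse.tail) (by simp)
  refine (h₁.seq (Exec.pop.seq ((h₂.of_start_eq (by simp [ht])).seq Exec.push))).of_eq ?_ ?_
  · funext j
    grind [update_apply]
  · grind

section Each

variable {k t : K} {ι : Type*} {ξ : ι → Γ} {body : Γ → Prog K Γ} {C : ℕ} {l : List ι}
  {S : List ι → List ι → K → List Γ}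

theorem exec_loop_push (hkt : k ≠ t)
    (hbody : ∀ l₁ i l₂, l = l₁ ++ i :: l₂ → ∀ a b, Exec R (body (ξ i))
      (update (update (S l₁ (i :: l₂)) k a) t b) (update (update (S (l₁ ++ [i]) l₂) k a) t b) C) :
    Exec R (.loop k fun x => .push t x ;; body x) (update (update (S [] l) k (l.map ξ)) t [])
      (update (update (S l []) k []) t (l.map ξ).reverse) (l.length * (C + 2) + 1) := by
  refine (exec_loop (k := k) (l := l) (C := 1 + C) (body := fun x => .push t x ;; body x)
    (S := fun l₁ l₂ => update (update (S l₁ l₂) k (l₂.map ξ)) t (l₁.map ξ).reverse)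
    (by simp [hkt]) fun l₁ i l₂ hl => ⟨ξ i, l₂.map ξ, by simp [hkt], ?_⟩).mono (by ring_nf; omega)
  have body' := hbody l₁ i l₂ hl (l₂.map ξ) (ξ i :: (l₁.map ξ).reverse)
  refine (Exec.push.seq (body'.of_start_eq ?_)).of_eq (by simp) le_rfl
  funext j
  grind [update_apply]

theorem exec_each (hkt : k ≠ t) {s s' : K → List Γ} (hs : s = S [] l) (hs' : s' = S l [])
    (hk : s k = l.map ξ) (ht : s t = []) (hk' : s' k = l.map ξ) (ht' : s' t = [])
    (hbody : ∀ l₁ i l₂, l = l₁ ++ i :: l₂ → ∀ a b, Exec R (body (ξ i))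
      (update (update (S l₁ (i :: l₂)) k a) t b)
      (update (update (S (l₁ ++ [i]) l₂) k a) t b) C) :
    Exec R (each k t body) s s' (l.length * (C + 4) + 2) := by
  have loop := exec_loop_push hkt hbody
  have restore := exec_move (R := R) hkt.symm (x := (l.map ξ).reverse)
    (s := update (update (S l []) k []) t (l.map ξ).reverse) (by simp)
  have start : s = update (update (S [] l) k (l.map ξ)) t [] := by
    rw [← hs, ← hk, update_eq_self, ← ht, update_eq_self]
  refine ((loop.of_start_eq start).seq restore).of_eq ?_
    (by simp only [List.length_reverse, List.length_map]; ring_nf; omega)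
  funext j
  grind [update_apply]

end Each

section Emits

variable {P Q : (K → List Γ) → Prop} {p q : Prog K Γ} {o : K} {w w' : List Γ} {C C' : ℕ}

/-- `Emits R P p o w C`: when `P` holds, the program `p` pushes the string `w` to the stack `o` in
time at most `C` and changes nothing else. -/
def Emits (R : List Γ → List Γ → ℕ → Prop) (P : (K → List Γ) → Prop) (p : Prog K Γ) (o : K)
    (w : List Γ) (C : ℕ) : Prop :=
  ∀ s, P s → Exec R p s (update s o (w.reverse ++ s o)) C

theorem Emits.skip : Emits R P .skip o [] 1 := fun s _ => Exec.skip.of_eq (by simp) le_rfl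

theorem Emits.push {a : Γ} : Emits R P (.push o a) o [a] 1 :=
  fun s _ => Exec.push.of_eq (by simp) le_rfl

theorem Emits.seq (hP : ∀ s x, P s → P (update s o x)) (hp : Emits R P p o w C)
    (hq : Emits R P q o w' C') : Emits R P (p ;; q) o (w ++ w') (C + C') :=
  fun s hs => ((hp s hs).seq (hq _ (hP s _ hs))).of_eq (by simp) le_rfl

theorem Emits.weaken (h : Emits R P p o w C) (hQ : ∀ s, Q s → P s) (hC : C ≤ C') :
    Emits R Q p o w C' :=
  fun s hs => (h s (hQ s hs)).mono hC

theorem emits_pushAll (w : List Γ) :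
    Emits R (fun _ => True) (pushAll o w) o w (w.length + 1) := by
  induction w with
  | nil => exact Emits.skip
  | cons a w ih => exact (Emits.push.seq (fun _ _ _ => trivial) ih).weaken (fun _ h => h) (by grind)

theorem Emits.each {k t : K} (hkt : k ≠ t) (hko : k ≠ o) (hto : t ≠ o) {ι : Type*} {ξ : ι → Γ}
    {f : ι → List Γ} {l : List ι} {body : Γ → Prog K Γ} (hP : ∀ s, P s → s k = l.map ξ ∧ s t = [])
    (hQ : ∀ s a b c, P s → Q (update (update (update s o c) k a) t b))
    (hbody : ∀ i ∈ l, Emits R Q (body (ξ i)) o (f i) C) :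
    Emits R P (each k t body) o (l.flatMap f) (l.length * (C + 4) + 2) := by
  intro s hs
  obtain ⟨hk, ht⟩ := hP s hs
  refine exec_each (ξ := ξ) (l := l) (C := C)
    (S := fun l₁ _ => update s o ((l₁.flatMap f).reverse ++ s o)) hkt (by simp) rfl hk ht
    (by simpa [hko] using hk) (by simpa [hto] using ht) ?_
  intro l₁ i l₂ hl a b
  refine (hbody i (by simp [hl]) _ (hQ s a b _ hs)).of_eq ?_ le_rfl
  funext j
  simp only [update_apply]
  split_ifs <;> simp_all

theorem exec_each_push {k t : K} (hkt : k ≠ t) (hko : k ≠ o) (hto : t ≠ o) {g : Γ → Γ}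
    {x : List Γ} {s : K → List Γ} (hk : s k = x) (ht : s t = []) :
    Exec R (each k t fun c => .push o (g c)) s (update s o ((x.map g).reverse ++ s o))
      (x.length * 5 + 2) := by
  rw [List.map_eq_flatMap]
  exact Emits.each (P := (· = s)) (Q := fun _ => True) (ξ := id) (C := 1) (l := x)
    (f := fun c => [g c]) (body := fun c => .push o (g c)) hkt hko hto
    (by rintro _ rfl; simp [hk, ht]) (by simp) (fun _ _ => Emits.push) s rfl

end Emits

end Basic

end StackProgram

namespace StackProgram

open Function Computability

/-! ### Binary numbers -/

/-- The successor of a binary number, least significant bit first. -/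
def incBits : List Bool → List Bool
  | [] => [true]
  | false :: l => true :: l
  | true :: l => false :: incBits l

theorem encodePosNum_succ (n : PosNum) : encodePosNum n.succ = incBits (encodePosNum n) := by
  induction n with
  | one => rfl
  | bit0 n _ => rfl
  | bit1 n ih => rw [PosNum.succ, encodePosNum, ih, encodePosNum, incBits]

theorem encodeNat_succ (n : ℕ) : encodeNat (n + 1) = incBits (encodeNat n) := by
  rw [encodeNat, encodeNat, Nat.cast_succ, Num.add_one]
  cases (n : Num) with
  | zero => rfl
  | pos p => exact encodePosNum_succ p

theorem length_incBits_le (l : List Bool) : (incBits l).length ≤ l.length + 1 := by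
  induction l with
  | nil => simp [incBits]
  | cons b l ih => cases b <;> simp [incBits, ih]

theorem length_encodeNat_le (n : ℕ) : (encodeNat n).length ≤ n := by
  induction n with
  | zero => rfl
  | succ n ih =>
    rw [encodeNat_succ]
    exact (length_incBits_le _).trans (Nat.succ_le_succ ih)

/-- The value of a binary number, most significant bit first. -/
def bitsValue (l : List Bool) : ℕ := l.foldl (fun v b => 2 * v + b.toNat) 0

theorem bitsValue_append_singleton (l : List Bool) (b : Bool) :
    bitsValue (l ++ [b]) = 2 * bitsValue l + b.toNat := by
  simp [bitsValue]

theorem bitsValue_le_append (l l' : List Bool) : bitsValue l ≤ bitsValue (l ++ l') := by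
  induction l' using List.reverseRecOn with
  | nil => simp
  | append_singleton l' b ih =>
    rw [← List.append_assoc, bitsValue_append_singleton]
    omega

theorem bitsValue_reverse_incBits (l : List Bool) :
    bitsValue (incBits l).reverse = bitsValue l.reverse + 1 := by
  induction l with
  | nil => rfl
  | cons b l ih => cases b <;> grind [incBits, bitsValue_append_singleton]

theorem bitsValue_reverse_encodeNat (n : ℕ) : bitsValue (encodeNat n).reverse = n := by
  induction n with
  | zero => rfl
  | succ n ih => rw [encodeNat_succ, bitsValue_reverse_incBits, ih]

section Numbers

variable {K : Type} [DecidableEq K] {R : List (Option Bool) → List (Option Bool) → ℕ → Prop}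
  {s : K → List (Option Bool)}

/-- The loop of `readNum`. It goes on as long as it leaves a symbol on the stack `c`. -/
def readBits (i o c : K) : Prog K (Option Bool) :=
  .loop c fun _ => .branch i fun
    | some (some b) => .pop i ;; .push o (some b) ;; .push c none
    | _ => .pop i

/-- Moves the bits before the next separator from the stack `i` to the stack `o` and removes the
separator. -/
def readNum (i o c : K) : Prog K (Option Bool) := .push c none ;; readBits i o c

theorem exec_readBits {i o c : K} (hio : i ≠ o) (hic : i ≠ c) (hoc : o ≠ c) {l : List Bool}
    {r : List (Option Bool)} (hi : s i = l.map some ++ none :: r) (hc : s c = [none]) :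
    Exec R (readBits i o c) s (update (update (update s i r) o ((l.map some).reverse ++ s o)) c [])
      (5 * l.length + 4) := by
  induction l generalizing s with
  | nil =>
    have body : Exec R (.pop i) (update s c []) (update (update s c []) i r) 1 :=
      Exec.pop.of_eq (by simp [hic, hi]) le_rfl
    refine (Exec.loop_cons hc (Exec.branch (by simpa [hic, hi] using body))
      (Exec.loop_nil (by simp [hic.symm]))).of_eq ?_ (by simp)
    funext j
    grind [update_apply]
  | cons b l ih =>
    have body : Exec R (.pop i ;; .push o (some b) ;; .push c none) (update s c [])
        (update (update (update s i (l.map some ++ none :: r)) o (some b :: s o)) c [none]) 3 := by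
      refine (Exec.pop.seq (Exec.push.seq Exec.push)).of_eq ?_ le_rfl
      funext j
      grind [update_apply]
    refine (Exec.loop_cons hc (Exec.branch (by simpa [hic, hi] using body))
      (ih (by simp [hic, hio]) (by simp))).of_eq ?_ (by grind)
    funext j
    grind [update_apply]

theorem exec_readNum {i o c : K} (hio : i ≠ o) (hic : i ≠ c) (hoc : o ≠ c) {l : List Bool}
    {r : List (Option Bool)} (hi : s i = l.map some ++ none :: r) (hc : s c = []) :
    Exec R (readNum i o c) s (update (update s i r) o ((l.map some).reverse ++ s o))
      (5 * l.length + 5) := by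
  have loop := exec_readBits (R := R) (s := update s c [none]) hio hic hoc (l := l) (r := r)
    (by simpa [hic] using hi) (by simp)
  refine (Exec.push.seq (loop.of_start_eq (by rw [hc]))).of_eq ?_ (by omega)
  funext j
  grind [update_apply]

/-- The loop of `increment`. It moves the changed lower bits to the stack `t`, and goes on as long
as it leaves a symbol on the stack `c`. -/
def carry (k t c : K) : Prog K (Option Bool) :=
  .loop c fun _ => .branch k fun
    | some (some true) => .pop k ;; .push t (some false) ;; .push c none
    | some (some false) => .pop k ;; .push k (some true)
    | _ => .push k (some true)

/-- Increments the binary number on the stack `k`. -/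
def increment (k t c : K) : Prog K (Option Bool) := .push c none ;; carry k t c ;; move t k

theorem exec_carry {k t c : K} (hkt : k ≠ t) (hkc : k ≠ c) (htc : t ≠ c) {l : List Bool}
    (hk : s k = l.map some) (hc : s c = [none]) :
    ∃ z r : List Bool, z.length ≤ l.length ∧ incBits l = z.reverse ++ r ∧
      Exec R (carry k t c) s
        (update (update (update s k (r.map some)) t (z.map some ++ s t)) c [])
        (5 * l.length + 5) := by
  induction l generalizing s with
  | nil =>
    have body : Exec R (.push k (some true)) (update s c [])
        (update (update s c []) k [some true]) 1 :=
      Exec.push.of_eq (by simp [hkc, hk]) le_rfl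
    refine ⟨[], [true], by simp, rfl, (Exec.loop_cons hc
      (Exec.branch (by simpa [hkc, hk] using body)) (Exec.loop_nil (by simp [hkc.symm]))).of_eq
      ?_ (by simp)⟩
    funext j
    grind [update_apply]
  | cons b l ih =>
    cases b with
    | false =>
      have body : Exec R (.pop k ;; .push k (some true)) (update s c [])
          (update (update s c []) k ((true :: l).map some)) 2 :=
        (Exec.pop.seq Exec.push).of_eq (by simp [hkc, hk]) le_rfl
      refine ⟨[], true :: l, by simp, rfl, (Exec.loop_cons hc
        (Exec.branch (by simpa [hkc, hk] using body)) (Exec.loop_nil (by simp [hkc.symm]))).of_eq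
        ?_ (by simp)⟩
      funext j
      grind [update_apply]
    | true =>
      have body : Exec R (.pop k ;; .push t (some false) ;; .push c none) (update s c [])
          (update (update (update s k (l.map some)) t (some false :: s t)) c [none]) 3 := by
        refine (Exec.pop.seq (Exec.push.seq Exec.push)).of_eq ?_ le_rfl
        funext j
        grind [update_apply]
      obtain ⟨z, r, hz, hl, rest⟩ := ih (s := update (update (update s k (l.map some)) t
        (some false :: s t)) c [none]) (by simp [hkc, hkt]) (by simp)
      refine ⟨z ++ [false], r, by simpa using hz, by simp [incBits, hl], (Exec.loop_cons hc
        (Exec.branch (by simpa [hkc, hk] using body)) rest).of_eq ?_ (by grind)⟩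
      funext j
      grind [update_apply]

theorem exec_increment {k t c : K} (hkt : k ≠ t) (hkc : k ≠ c) (htc : t ≠ c) {l : List Bool}
    (hk : s k = l.map some) (ht : s t = []) (hc : s c = []) :
    Exec R (increment k t c) s (update s k ((incBits l).map some)) (7 * l.length + 7) := by
  obtain ⟨z, r, hz, hl, loop⟩ := exec_carry (R := R) (s := update s c [none]) hkt hkc htc (l := l)
    (by simpa [hkc] using hk) (by simp)
  have restore := exec_move (R := R) hkt.symm (x := z.map some) (s := update (update (update
    (update s c [none]) k (r.map some)) t (z.map some ++ update s c [none] t)) c [])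
    (by simp [htc, ht])
  refine (Exec.push.seq ((loop.of_start_eq (by rw [hc])).seq restore)).of_eq ?_
    (by simp only [List.length_map]; omega)
  rw [hl, List.map_append, List.map_reverse]
  funext j
  grind [update_apply]

/-- Doubles the unary number on the stack `u`. -/
def double (u t : K) : Prog K (Option Bool) :=
  .loop u (fun x => .push t x ;; .push t x) ;; move t u

theorem exec_loop_push_push {u t : K} (hut : u ≠ t) {a : Option Bool} {m : ℕ}
    (hu : s u = List.replicate m a) :
    Exec R (.loop u fun x => .push t x ;; .push t x) s
      (update (update s u []) t (List.replicate (2 * m) a ++ s t)) (3 * m + 1) := by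
  induction m generalizing s with
  | zero =>
    refine (Exec.loop_nil hu).of_eq ?_ le_rfl
    funext j
    grind [update_apply]
  | succ m ih =>
    have rest := ih (s := update (update s u (List.replicate m a)) t (a :: a :: s t))
      (by simp [hut])
    refine (Exec.loop_cons hu ((Exec.push.seq Exec.push).of_eq
      (by simp [hut.symm]) le_rfl) rest).of_eq ?_ (by omega)
    have : List.replicate (2 * (m + 1)) a = List.replicate (2 * m) a ++ [a, a] := by
      rw [mul_add, List.replicate_add]
      rfl
    funext j
    grind [update_apply]

theorem exec_double {u t : K} (hut : u ≠ t) {a : Option Bool} {m : ℕ}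
    (hu : s u = List.replicate m a) (ht : s t = []) :
    Exec R (double u t) s (update s u (List.replicate (2 * m) a)) (7 * m + 2) := by
  have restore := exec_move (R := R) hut.symm (x := List.replicate (2 * m) a)
    (s := update (update s u []) t (List.replicate (2 * m) a ++ s t)) (by simp [ht])
  refine ((exec_loop_push_push hut hu).seq restore).of_eq ?_
    (by simp only [List.length_replicate]; omega)
  funext j
  grind [update_apply]

/-- Pushes the unary representation of the binary number on the stack `k` (most significant bit
first) to the stack `u`. -/
def toUnary (k t u v : K) : Prog K (Option Bool) :=
  each k t fun b => double u v ;; if b = some true then .push u (some true) else .skip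

theorem exec_toUnary {k t u v : K} (hkt : k ≠ t) (hku : k ≠ u) (hkv : k ≠ v) (htu : t ≠ u)
    (htv : t ≠ v) (huv : u ≠ v) {l : List Bool} (hk : s k = l.map some) (ht : s t = [])
    (hu : s u = []) (hv : s v = []) :
    Exec R (toUnary k t u v) s (update s u (List.replicate (bitsValue l) (some true)))
      (l.length * (7 * bitsValue l + 7) + 2) := by
  refine exec_each (ξ := some) (l := l) (C := 7 * bitsValue l + 3)
    (S := fun l₁ _ => update s u (List.replicate (bitsValue l₁) (some true))) hkt
    (by simp [bitsValue, ← hu]) rfl hk ht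
    (by simpa [hku] using hk) (by simpa [htu] using ht) fun l₁ b l₂ hl x y => ?_
  have hle : bitsValue l₁ ≤ bitsValue l := hl ▸ bitsValue_le_append _ _
  have doubled := exec_double (R := R) huv (a := some true) (m := bitsValue l₁)
    (s := update (update (update s u (List.replicate (bitsValue l₁) (some true))) k x) t y)
    (by simp [hku.symm, htu.symm]) (by simp [htv.symm, hkv.symm, huv.symm, hv])
  cases b with
  | true =>
    refine (doubled.seq Exec.push).of_eq ?_ (by omega)
    rw [bitsValue_append_singleton, Bool.toNat_true, List.replicate_succ]
    funext j
    grind [update_apply]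
  | false =>
    refine (doubled.seq Exec.skip).of_eq ?_ (by omega)
    rw [bitsValue_append_singleton, Bool.toNat_false, add_zero]
    funext j
    grind [update_apply]

theorem exec_toUnary_encodeNat {k t u v : K} (hkt : k ≠ t) (hku : k ≠ u) (hkv : k ≠ v)
    (htu : t ≠ u) (htv : t ≠ v) (huv : u ≠ v) {n : ℕ}
    (hk : s k = ((encodeNat n).map some).reverse) (ht : s t = []) (hu : s u = []) (hv : s v = []) :
    Exec R (toUnary k t u v) s (update s u (List.replicate n (some true)))
      (n * (7 * n + 7) + 2) := by
  have unary := exec_toUnary (R := R) hkt hku hkv htu htv huv (l := (encodeNat n).reverse)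
    (by rw [hk, List.map_reverse]) ht hu hv
  rw [bitsValue_reverse_encodeNat, List.length_reverse] at unary
  exact unary.mono (by gcongr; exact length_encodeNat_le n)

end Numbers

end StackProgram

namespace ElectionControl

open Finset

/-! ### Diffusion and votes in elections between two candidates -/

theorem isInfluenced_iff_eq_or_mem {n : ℕ} {H : Finset (Fin n × Fin n)}
    (hH : ∀ u v w, (u, v) ∈ H → (v, w) ∈ H → u = v) {s v : Fin n} :
    IsInfluenced H s v ↔ s = v ∨ (s, v) ∈ H := by
  constructor
  · rintro ⟨t, ht⟩
    induction t generalizing v with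
    | zero => simp_all [cascade]
    | succ t ih =>
      simp only [cascade, mem_filter, mem_univ, true_and] at ht
      obtain ⟨-, u, hu, huv⟩ := ht
      rcases ih hu with rfl | hsu
      · exact Or.inr huv
      · exact Or.inr (hH s u v hsu huv ▸ huv)
  · intro h
    by_cases hsv : s = v
    · exact ⟨0, by simp [cascade, hsv]⟩
    · exact ⟨1, by simpa [cascade, Ne.symm hsv] using h.resolve_left hsv⟩

namespace SeedPlan

variable {ℓ n : ℕ} {P : SeedPlan ℓ n} {m : Fin (ℓ + 1) → ℤ}

/-- The seeds of a plan. -/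
def seeds (P : SeedPlan ℓ n) : Finset (Fin n) := {s | (P s).isSome}

theorem mem_seeds {s : Fin n} : s ∈ P.seeds ↔ (P s).isSome := by
  simp [seeds]

theorem info_of_forall_eq (h : ∀ s m', P s = some m' → m' = m) (s : Fin n) :
    P.info s = if s ∈ P.seeds then m else 0 := by
  funext i
  unfold info
  cases hs : P s with
  | none => simp [mem_seeds, hs]
  | some m' => simp [mem_seeds, hs, h s m' hs]

theorem IsSingleNews.card_seeds (hP : P.IsSingleNews) : P.seeds.card = P.cost := by
  obtain ⟨j, q, hq, h⟩ := hP
  have hjq : ∑ i, ((Pi.single j q : Fin (ℓ + 1) → ℤ) i).natAbs = 1 := by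
    rw [Fintype.sum_eq_single j fun i hi => by simp [hi]]
    rcases hq with rfl | rfl <;> simp
  have (s : Fin n) : ∑ i, (P.info s i).natAbs = if s ∈ P.seeds then 1 else 0 := by
    rw [info_of_forall_eq h]
    split_ifs
    · exact hjq
    · simp
  simp only [cost, this, sum_boole, Nat.cast_id, filter_univ_mem]

open Classical in
/-- The number of messages that reach a voter. -/
noncomputable def received (P : SeedPlan ℓ n) (H : Finset (Fin n × Fin n)) (v : Fin n) : ℕ :=
  #{s ∈ P.seeds | IsInfluenced H s v}

theorem sum_info_of_forall_eq {H : Finset (Fin n × Fin n)} {v : Fin n}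
    [DecidablePred (IsInfluenced H · v)] (h : ∀ s m', P s = some m' → m' = m) (i : Fin (ℓ + 1)) :
    ∑ s with IsInfluenced H s v, P.info s i = m i * P.received H v := by
  classical
  have (s : Fin n) : P.info s i = if s ∈ P.seeds then m i else 0 := by
    rw [info_of_forall_eq h]
    split_ifs <;> rfl
  simp only [this, ← sum_filter, sum_const, nsmul_eq_mul, received, mul_comm (m i)]
  congr 3
  ext s
  simp [and_comm]

end SeedPlan

namespace Election

theorem score_le_sup {ℓ : ℕ} (J : Election ℓ) (v : Fin J.n) (i : Fin (ℓ + 1)) :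
    J.π v i ≤ univ.sup fun v => univ.sup (J.π v) :=
  (le_sup (f := J.π v) (mem_univ i)).trans
    (le_sup (f := fun v => univ.sup (J.π v)) (mem_univ v))

theorem ε_lt_one_of_pos {ℓ : ℕ} {J : Election ℓ} {v : Fin J.n} {i : Fin (ℓ + 1)}
    (h : 0 < J.π v i) : J.ε < 1 := by
  have : (0 : ℚ) < (univ.sup fun v => univ.sup (J.π v) : ℕ) := by
    exact_mod_cast h.trans_le (J.score_le_sup v i)
  rw [ε, div_lt_one (by positivity)]
  linarith

theorem expectedGain_of_forall_eq_one {ℓ : ℕ} {J : Election ℓ} (hp : ∀ e ∈ J.E, J.p e = 1)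
    (P : SeedPlan ℓ J.n) :
    J.expectedGain P = ((J.MoV P J.E - J.MoV SeedPlan.empty J.E : ℤ) : ℚ) := by
  rw [expectedGain, sum_eq_single_of_mem J.E (mem_powerset_self _)]
  · have : J.liveProb J.E = 1 := prod_eq_one fun e he => by simp [he, hp]
    rw [this, one_mul]
  · intro H hH hne
    obtain ⟨e, he, heH⟩ := exists_of_ssubset ((mem_powerset.1 hH).ssubset_of_ne hne)
    have : J.liveProb H = 0 := prod_eq_zero he (by simp [heH, hp e he])
    rw [this, zero_mul]

variable (J : Election 1) (P : SeedPlan 1 J.n) (H : Finset (Fin J.n × Fin J.n))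

/-- The lead of `c_0` over `c_1` in the revised preferences of a voter. -/
noncomputable def lead (v : Fin J.n) : ℚ := J.revisedScore P H v 0 - J.revisedScore P H v 1

theorem intCast_sign_mono {x y : ℚ} (h : x ≤ y) :
    (SignType.sign x : ℤ) ≤ SignType.sign y := by
  have := SignType.sign.monotone h
  generalize SignType.sign x = u, SignType.sign y = v at this
  revert u v
  decide

theorem MoV_eq_sum_sign_lead : J.MoV P H = ∑ v, (SignType.sign (J.lead P H v) : ℤ) := by
  classical
  have others : (univ.filter (· ≠ 0) : Finset (Fin 2)) = {1} := by decide
  simp only [MoV, others, sup_singleton, supporters, card_filter, Nat.cast_sum,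
    ← sum_sub_distrib]
  refine sum_congr rfl fun v _ => ?_
  rcases lt_trichotomy (J.revisedScore P H v 0) (J.revisedScore P H v 1) with h | h | h
  · simp [lead, Fin.forall_fin_two, h, h.not_gt, sign_neg (sub_neg.2 h)]
  · simp [lead, Fin.forall_fin_two, h]
  · simp [lead, Fin.forall_fin_two, h, h.not_gt, sign_pos (sub_pos.2 h)]

variable {J P}

theorem lead_of_forall_eq {m : Fin 2 → ℤ} (h : ∀ s m', P s = some m' → m' = m) (v : Fin J.n) :
    J.lead P H v =
      (1 - J.ε) * ((J.π v 0 : ℚ) - J.π v 1) + (m 0 - m 1 : ℤ) * P.received H v := by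
  classical
  simp only [lead, revisedScore, ← Int.cast_sum, SeedPlan.sum_info_of_forall_eq h]
  push_cast
  ring

theorem exists_lead_eq (hP : P.IsSingleNews) : ∃ δ : ℚ, (δ = 1 ∨ δ = -1) ∧ ∀ v,
    J.lead P H v = (1 - J.ε) * ((J.π v 0 : ℚ) - J.π v 1) + δ * P.received H v := by
  obtain ⟨j, q, hq, h⟩ := hP
  refine ⟨_, ?_, lead_of_forall_eq H h⟩
  fin_cases j <;> rcases hq with rfl | rfl <;> simp

theorem lead_empty (v : Fin J.n) :
    J.lead SeedPlan.empty H v = (1 - J.ε) * ((J.π v 0 : ℚ) - J.π v 1) := by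
  rw [lead_of_forall_eq (m := 0) H (by simp [SeedPlan.empty])]
  simp

end Election

/-! ### The reduction -/

open Classical in
/-- The election obtained from an instance of Densest-`k`-Subgraph. Its voters are the pairs of
vertices. The pair `(a, a)` influences the pairs that contain `a`. A voter `(a, b)` that is an edge
of the graph prefers `c_1` by two points, and all others prefer `c_0`. -/
noncomputable def reduction (I : DkSInstance) : ECSInstance 1 where
  n := I.n * I.n
  E := {e | (finProdFinEquiv.symm e.1).1 = (finProdFinEquiv.symm e.1).2 ∧
    ((finProdFinEquiv.symm e.1).1 = (finProdFinEquiv.symm e.2).1 ∨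
      (finProdFinEquiv.symm e.1).1 = (finProdFinEquiv.symm e.2).2)}
  p _ := 1
  p_nonneg _ := zero_le_one
  p_le_one _ := le_rfl
  π v := if I.G.Adj (finProdFinEquiv.symm v).1 (finProdFinEquiv.symm v).2 then ![0, 2] else ![1, 0]
  π_injective v := by
    intro i j h
    split_ifs at h <;> fin_cases i <;> fin_cases j <;> simp_all
  B := I.k

section Reduction

variable {I : DkSInstance} {a b c d : Fin I.n}

/-- The voter of the reduction that belongs to a pair of vertices. -/
def voter (a b : Fin I.n) : Fin (reduction I).n := finProdFinEquiv (a, b)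

theorem exists_eq_voter (v : Fin (reduction I).n) : ∃ a b : Fin I.n, v = voter a b :=
  ⟨(finProdFinEquiv.symm v).1, (finProdFinEquiv.symm v).2,
    (finProdFinEquiv.apply_symm_apply v).symm⟩

@[simp] theorem voter_inj : voter a b = voter c d ↔ a = c ∧ b = d :=
  finProdFinEquiv.apply_eq_iff_eq.trans Prod.mk_inj

theorem symm_voter (a b : Fin I.n) : finProdFinEquiv.symm (voter a b) = (a, b) :=
  finProdFinEquiv.symm_apply_apply _

theorem mem_reduction_E : (voter a b, voter c d) ∈ (reduction I).E ↔ a = b ∧ (a = c ∨ a = d) := by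
  refine mem_filter.trans ?_
  rw [symm_voter a b, symm_voter c d]
  exact and_iff_right (mem_univ _)

theorem reduction_π_of_adj (h : I.G.Adj a b) : (reduction I).π (voter a b) = ![0, 2] := by
  refine if_pos ?_
  rwa [symm_voter]

theorem reduction_π_of_not_adj (h : ¬ I.G.Adj a b) : (reduction I).π (voter a b) = ![1, 0] := by
  refine if_neg ?_
  rwa [symm_voter]

theorem isInfluenced_reduction (hab : a ≠ b) {s : Fin (reduction I).n} :
    IsInfluenced (reduction I).E s (voter a b) ↔
      s = voter a a ∨ s = voter b b ∨ s = voter a b := by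
  rw [isInfluenced_iff_eq_or_mem]
  · obtain ⟨c, d, rfl⟩ := exists_eq_voter s
    rw [mem_reduction_E]
    simp only [voter_inj]
    grind
  · intro u v w huv hvw
    obtain ⟨a, b, rfl⟩ := exists_eq_voter u
    obtain ⟨c, d, rfl⟩ := exists_eq_voter v
    obtain ⟨e, f, rfl⟩ := exists_eq_voter w
    rw [mem_reduction_E] at huv hvw
    rw [voter_inj]
    grind

theorem reduction_ε_of_adj (h : I.G.Adj a b) : (reduction I).ε = 1 / 3 := by
  have : (univ.sup fun v => univ.sup ((reduction I).π v)) = 2 := by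
    refine le_antisymm (Finset.sup_le fun v _ => Finset.sup_le fun i _ => ?_) ?_
    · obtain ⟨c, d, rfl⟩ := exists_eq_voter v
      by_cases hcd : I.G.Adj c d
      · rw [reduction_π_of_adj hcd]
        fin_cases i <;> simp
      · rw [reduction_π_of_not_adj hcd]
        fin_cases i <;> simp
    · simpa [reduction_π_of_adj h] using
        (reduction I).toElection.score_le_sup (voter a b) 1
  rw [Election.ε, this]
  norm_num

/-! ### Margins of victory in the reduction -/

open Election

theorem lead_empty_of_adj (h : I.G.Adj a b)
    (H : Finset (Fin (reduction I).n × Fin (reduction I).n)) :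
    (reduction I).lead SeedPlan.empty H (voter a b) = -(4 / 3) := by
  rw [lead_empty, reduction_ε_of_adj h, reduction_π_of_adj h]
  norm_num

theorem lead_empty_of_not_adj (h : ¬ I.G.Adj a b)
    (H : Finset (Fin (reduction I).n × Fin (reduction I).n)) :
    0 < (reduction I).lead SeedPlan.empty H (voter a b) := by
  have : (reduction I).ε < 1 :=
    ε_lt_one_of_pos (v := voter a b) (i := 0) (by simp [reduction_π_of_not_adj h])
  rw [lead_empty, reduction_π_of_not_adj h]
  simpa using this

theorem expectedGain_reduction (P : SeedPlan 1 (reduction I).n) :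
    (reduction I).expectedGain P =
      ((∑ v, ((SignType.sign ((reduction I).lead P (reduction I).E v) : ℤ) -
        SignType.sign ((reduction I).lead SeedPlan.empty (reduction I).E v)) : ℤ) : ℚ) := by
  rw [expectedGain_of_forall_eq_one (fun _ _ => rfl), MoV_eq_sum_sign_lead, MoV_eq_sum_sign_lead,
    sum_sub_distrib]

open Classical in
/-- The voters of the reduction that are edges inside a set of vertices, in either direction. -/
noncomputable def edgeVoters (X : Finset (Fin I.n)) : Finset (Fin (reduction I).n) :=
  {v | ∃ a ∈ X, ∃ b ∈ X, I.G.Adj a b ∧ v = voter a b}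

theorem voter_mem_edgeVoters {X : Finset (Fin I.n)} :
    voter a b ∈ edgeVoters X ↔ a ∈ X ∧ b ∈ X ∧ I.G.Adj a b := by
  simp only [edgeVoters, mem_filter, mem_univ, true_and, voter_inj]
  grind

theorem card_edgeVoters (X : Finset (Fin I.n)) : #(edgeVoters X) = 2 * I.density X := by
  classical
  rw [DkSInstance.density, ← SimpleGraph.coe_edgeFinset, Set.ncard_coe_finset,
    SimpleGraph.two_mul_card_edgeFinset]
  refine (card_bij (fun e _ => voter e.1.1 e.2.1) ?_ ?_ ?_).symm
  · rintro ⟨a, b⟩ h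
    rw [mem_filter] at h
    exact voter_mem_edgeVoters.2 ⟨a.2, b.2, h.2⟩
  · rintro ⟨a, b⟩ _ ⟨c, d⟩ _ h
    rw [voter_inj] at h
    exact Prod.ext (Subtype.ext h.1) (Subtype.ext h.2)
  · intro v hv
    obtain ⟨a, b, rfl⟩ := exists_eq_voter v
    obtain ⟨ha, hb, hab⟩ := voter_mem_edgeVoters.1 hv
    exact ⟨(⟨a, ha⟩, ⟨b, hb⟩), by simpa using hab, rfl⟩

theorem density_mono {X Y : Finset (Fin I.n)} (h : X ⊆ Y) : I.density X ≤ I.density Y := by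
  have : #(edgeVoters X) ≤ #(edgeVoters Y) := by
    refine card_le_card fun v hv => ?_
    obtain ⟨a, b, rfl⟩ := exists_eq_voter v
    obtain ⟨ha, hb, hab⟩ := voter_mem_edgeVoters.1 hv
    exact voter_mem_edgeVoters.2 ⟨h ha, h hb, hab⟩
  rw [card_edgeVoters, card_edgeVoters] at this
  omega

theorem sum_edgeVoters (X : Finset (Fin I.n)) :
    ((∑ v, if v ∈ edgeVoters X then 2 else 0 : ℤ) : ℚ) = 4 * I.density X := by
  rw [sum_ite_mem, univ_inter, sum_const, card_edgeVoters, nsmul_eq_mul]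
  push_cast
  ring

theorem received_reduction (hab : a ≠ b) (P : SeedPlan 1 (reduction I).n) :
    P.received (reduction I).E (voter a b) =
      #{s ∈ ({voter a a, voter b b, voter a b} : Finset (Fin (reduction I).n)) | s ∈ P.seeds} := by
  classical
  rw [SeedPlan.received]
  congr 1
  ext s
  simp only [mem_filter, mem_insert, mem_singleton, isInfluenced_reduction hab, and_comm]

/-- The vertices chosen according to a seed plan. -/
noncomputable def chosen (P : SeedPlan 1 (reduction I).n) : Finset (Fin I.n) :=
  {v | (∃ a, voter a v ∈ P.seeds) ∨ ∃ b, voter v b ∈ P.seeds ∧ voter b b ∈ P.seeds}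

theorem mem_chosen {P : SeedPlan 1 (reduction I).n} : a ∈ chosen P ↔
    (∃ b, voter b a ∈ P.seeds) ∨ ∃ b, voter a b ∈ P.seeds ∧ voter b b ∈ P.seeds := by
  simp [chosen]

/-- The seed `(a, b)` accounts for `a` if `(b, b)` is a seed too, and for `b` otherwise. -/
theorem card_chosen_le (P : SeedPlan 1 (reduction I).n) : #(chosen P) ≤ #P.seeds := by
  classical
  let f : Fin (reduction I).n → Fin I.n := fun s =>
    let e := finProdFinEquiv.symm s
    if voter e.2 e.2 ∈ P.seeds then e.1 else e.2
  have hf (a b : Fin I.n) : f (voter a b) = if voter b b ∈ P.seeds then a else b := by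
    simp only [f, symm_voter]
  have : chosen P ⊆ P.seeds.image f := by
    intro v hv
    rw [mem_chosen] at hv
    rw [mem_image]
    by_cases hvv : voter v v ∈ P.seeds
    · exact ⟨_, hvv, by simp [hf]⟩
    · rcases hv with ⟨a, ha⟩ | ⟨b, hb, hbb⟩
      · exact ⟨_, ha, by rw [hf, if_neg hvv]⟩
      · exact ⟨_, hb, by rw [hf, if_pos hbb]⟩
  exact (card_le_card this).trans card_image_le

theorem mem_chosen_of_two_le_received {P : SeedPlan 1 (reduction I).n} (hab : a ≠ b)
    (h : 2 ≤ P.received (reduction I).E (voter a b)) : a ∈ chosen P ∧ b ∈ chosen P := by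
  rw [received_reduction hab, card_filter, sum_insert (by simp [hab]),
    sum_insert (by simp [hab.symm]), sum_singleton] at h
  rw [mem_chosen, mem_chosen]
  grind

theorem sign_lead_sub_le {P : SeedPlan 1 (reduction I).n} (hP : P.IsSingleNews)
    (v : Fin (reduction I).n) :
    (SignType.sign ((reduction I).lead P (reduction I).E v) : ℤ) -
      SignType.sign ((reduction I).lead SeedPlan.empty (reduction I).E v) ≤
        if v ∈ edgeVoters (chosen P) then 2 else 0 := by
  obtain ⟨δ, hδ, hlead⟩ := exists_lead_eq (J := (reduction I).toElection) (reduction I).E hP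
  obtain ⟨a, b, rfl⟩ := exists_eq_voter v
  have sign_le (x : ℚ) : (SignType.sign x : ℤ) ≤ 1 := by cases SignType.sign x <;> decide
  by_cases hab : I.G.Adj a b
  · have hempty := lead_empty_of_adj hab (reduction I).E
    have hsign : (SignType.sign ((reduction I).lead SeedPlan.empty (reduction I).E (voter a b)) : ℤ)
        = -1 := by rw [hempty, sign_neg (by norm_num)]; rfl
    rw [hsign]
    split_ifs with hmem
    · linarith [sign_le ((reduction I).lead P (reduction I).E (voter a b))]
    · have hrec : P.received (reduction I).E (voter a b) ≤ 1 := by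
        by_contra! h
        obtain ⟨ha, hb⟩ := mem_chosen_of_two_le_received hab.ne h
        exact hmem (voter_mem_edgeVoters.2 ⟨ha, hb, hab⟩)
      have : (0 : ℚ) ≤ P.received (reduction I).E (voter a b) := Nat.cast_nonneg _
      have hrec₁ : (P.received (reduction I).E (voter a b) : ℚ) ≤ 1 := mod_cast hrec
      have hneg : (reduction I).lead P (reduction I).E (voter a b) < 0 := by
        rw [hlead, ← lead_empty (reduction I).E, hempty]
        rcases hδ with rfl | rfl <;> linarith
      rw [sign_neg hneg]
      decide
  · rw [sign_pos (lead_empty_of_not_adj hab _)]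
    refine (sub_nonpos.2 (sign_le _)).trans ?_
    split_ifs <;> norm_num

theorem expectedGain_le {P : SeedPlan 1 (reduction I).n} (hP : P.IsSingleNews) :
    (reduction I).expectedGain P ≤ 4 * I.density (chosen P) := by
  rw [expectedGain_reduction, ← sum_edgeVoters]
  exact_mod_cast sum_le_sum fun v _ => sign_lead_sub_le hP v

open Classical in
/-- The seed plan that belongs to a set of vertices. -/
noncomputable def planOf (X : Finset (Fin I.n)) : SeedPlan 1 (reduction I).n :=
  fun s => if ∃ a ∈ X, s = voter a a then some (Pi.single 0 1) else none

theorem eq_single_of_planOf_eq_some (X : Finset (Fin I.n)) (s : Fin (reduction I).n) (m : Fin 2 → ℤ)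
    (h : planOf X s = some m) : m = Pi.single 0 1 := by
  rw [planOf] at h
  split_ifs at h
  exact (Option.some_injective _ h).symm

theorem planOf_isSingleNews (X : Finset (Fin I.n)) : (planOf X).IsSingleNews :=
  ⟨0, 1, Or.inl rfl, eq_single_of_planOf_eq_some X⟩

theorem seeds_planOf (X : Finset (Fin I.n)) :
    (planOf X).seeds = X.image fun a => voter a a := by
  ext s
  simp only [SeedPlan.mem_seeds, planOf, mem_image, Option.isSome_ite, eq_comm (a := s)]

theorem card_seeds_planOf (X : Finset (Fin I.n)) : #(planOf X).seeds = #X := by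
  rw [seeds_planOf, card_image_of_injective _ fun a b h => (voter_inj.1 h).1]

theorem two_le_received_planOf {X : Finset (Fin I.n)} (hab : a ≠ b) (ha : a ∈ X) (hb : b ∈ X) :
    2 ≤ (planOf X).received (reduction I).E (voter a b) := by
  rw [received_reduction hab, card_filter, sum_insert (by simp [hab]),
    sum_insert (by simp [hab.symm]), sum_singleton, seeds_planOf]
  simp [ha, hb, hab.symm]

theorem le_sign_lead_planOf_sub (X : Finset (Fin I.n)) (v : Fin (reduction I).n) :
    (if v ∈ edgeVoters X then 2 else 0) ≤
      (SignType.sign ((reduction I).lead (planOf X) (reduction I).E v) : ℤ) -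
        SignType.sign ((reduction I).lead SeedPlan.empty (reduction I).E v) := by
  have hlead (v) : (reduction I).lead (planOf X) (reduction I).E v =
      (reduction I).lead SeedPlan.empty (reduction I).E v +
        (planOf X).received (reduction I).E v := by
    rw [lead_of_forall_eq _ (eq_single_of_planOf_eq_some X), lead_empty]
    simp
  obtain ⟨a, b, rfl⟩ := exists_eq_voter v
  split_ifs with hmem
  · obtain ⟨ha, hb, hab⟩ := voter_mem_edgeVoters.1 hmem
    have hrec : (2 : ℚ) ≤ (planOf X).received (reduction I).E (voter a b) :=
      mod_cast two_le_received_planOf hab.ne ha hb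
    have hempty := lead_empty_of_adj hab (reduction I).E
    rw [sign_neg (hempty.trans_lt (by norm_num)), sign_pos (by rw [hlead, hempty]; linarith)]
    decide
  · exact sub_nonneg.2 (intCast_sign_mono
      ((le_add_of_nonneg_right (Nat.cast_nonneg _)).trans_eq (hlead _).symm))

theorem le_expectedGain_planOf (X : Finset (Fin I.n)) :
    4 * (I.density X : ℚ) ≤ (reduction I).expectedGain (planOf X) := by
  rw [expectedGain_reduction, ← sum_edgeVoters]
  exact_mod_cast sum_le_sum fun v _ => le_sign_lead_planOf_sub X v

end Reduction

end ElectionControl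

namespace ElectionControl

open Finset

/-- Sets the first `r` bits that are `false` to `true`. -/
def padBits : ℕ → List Bool → List Bool
  | _, [] => []
  | r, true :: l => true :: padBits r l
  | 0, false :: l => false :: padBits 0 l
  | r + 1, false :: l => true :: padBits r l

@[simp] theorem length_padBits (r : ℕ) (l : List Bool) : (padBits r l).length = l.length := by
  fun_induction padBits r l <;> simp_all

theorem count_padBits (r : ℕ) (l : List Bool) (h : l.count true + r ≤ l.length) :
    (padBits r l).count true = l.count true + r := by
  fun_induction padBits r l with
  | case1 => simp_all
  | case2 r l ih => grind
  | case3 l ih => grind [List.count_le_length]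
  | case4 r l ih => grind

theorem getD_padBits (r : ℕ) (l : List Bool) (i : ℕ) (h : l.getD i false = true) :
    (padBits r l).getD i false = true := by
  fun_induction padBits r l generalizing i with
  | case1 => simp at h
  | _ => cases i <;> simp_all

theorem map_finRange_getD {n : ℕ} {l : List Bool} (h : l.length = n) :
    (List.finRange n).map (fun v : Fin n => l.getD v.1 false) = l := by
  apply List.ext_getElem
  · simp [h]
  · intro i h₁ h₂
    simp [h₂]

theorem card_filter_eq_count {n : ℕ} (f : Fin n → Bool) :
    #{v | f v = true} = ((List.finRange n).map f).count true := by
  rw [List.count, List.countP_map, Finset.card, Finset.filter, Fin.univ_def]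
  simp only [Multiset.filter_coe, Multiset.coe_card, List.countP_eq_length_filter]
  simp [Function.comp_def]

section Padding

variable {I : DkSInstance}

/-- The characteristic vector of the chosen vertices. -/
noncomputable def chosenBits (P : SeedPlan 1 (reduction I).n) : List Bool :=
  (List.finRange I.n).map fun v => decide (v ∈ chosen P)

/-- The characteristic vector of the chosen vertices, padded to `k` vertices. -/
noncomputable def finalBits (P : SeedPlan 1 (reduction I).n) : List Bool :=
  padBits (I.k - (chosenBits P).count true) (chosenBits P)

/-- The chosen vertices, padded to a set of `k` vertices. -/
noncomputable def finalSet (P : SeedPlan 1 (reduction I).n) : Finset (Fin I.n) :=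
  {v | (finalBits P).getD v false = true}

theorem length_finalBits (P : SeedPlan 1 (reduction I).n) : (finalBits P).length = I.n := by
  simp [finalBits, chosenBits]

theorem count_chosenBits (P : SeedPlan 1 (reduction I).n) :
    (chosenBits P).count true = (chosen P).card := by
  simp [chosenBits, ← card_filter_eq_count]

theorem card_finalSet {P : SeedPlan 1 (reduction I).n} (hP : (reduction I).Feasible P) :
    (finalSet P).card = I.k := by
  have h : (chosen P).card ≤ I.k :=
    (card_chosen_le P).trans (hP.1.card_seeds.le.trans hP.2)
  have hk := I.k_le
  rw [finalSet, card_filter_eq_count, map_finRange_getD (length_finalBits P), finalBits,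
    count_padBits, count_chosenBits]
  · omega
  · rw [count_chosenBits]
    simp only [chosenBits, List.length_map, List.length_finRange]
    omega

theorem chosen_subset_finalSet (P : SeedPlan 1 (reduction I).n) : chosen P ⊆ finalSet P := by
  intro v hv
  simp only [finalSet, mem_filter, mem_univ, true_and]
  apply getD_padBits
  simp [chosenBits, hv]

theorem planOf_feasible {X : Finset (Fin I.n)} (hX : X.card = I.k) :
    (reduction I).Feasible (planOf X) := by
  refine ⟨planOf_isSingleNews X, ?_⟩
  rw [← (planOf_isSingleNews X).card_seeds, card_seeds_planOf, hX]
  exact le_rfl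

theorem mul_density_le_density_finalSet {ρ : ℝ} (hρ : 0 < ρ) {P : SeedPlan 1 (reduction I).n}
    (hP : (reduction I).Feasible P)
    (hA : ∀ Q : SeedPlan 1 (reduction I).n, (reduction I).Feasible Q →
      ρ * ((reduction I).expectedGain Q : ℝ) ≤ ((reduction I).expectedGain P : ℝ))
    {X : Finset (Fin I.n)} (hX : X.card = I.k) :
    ρ * (I.density X : ℝ) ≤ (I.density (finalSet P) : ℝ) := by
  have key : 4 * (ρ * I.density X) ≤ 4 * (I.density (finalSet P) : ℝ) := calc
    4 * (ρ * I.density X) = ρ * (4 * I.density X : ℝ) := by ring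
    _ ≤ ρ * ((reduction I).expectedGain (planOf X) : ℝ) := by
      gcongr
      exact_mod_cast le_expectedGain_planOf X
    _ ≤ ((reduction I).expectedGain P : ℝ) := hA _ (planOf_feasible hX)
    _ ≤ 4 * I.density (chosen P) := by exact_mod_cast expectedGain_le hP.1
    _ ≤ 4 * (I.density (finalSet P) : ℝ) := by
      gcongr
      exact density_mono (chosen_subset_finalSet P)
  linarith

end Padding

/-! ### The encodings -/

theorem encodeNats_nil : encodeNats [] = [] := rfl

theorem encodeNats_cons (a : ℕ) (l : List ℕ) :
    encodeNats (a :: l) = (Computability.encodeNat a).map some ++ none :: encodeNats l := by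
  simp [encodeNats]

theorem encodeNats_append (l l' : List ℕ) : encodeNats (l ++ l') = encodeNats l ++ encodeNats l' :=
  List.flatMap_append

theorem encodeNats_flatMap {α : Type*} (l : List α) (f : α → List ℕ) :
    encodeNats (l.flatMap f) = l.flatMap fun a => encodeNats (f a) :=
  List.flatMap_assoc

theorem encodeNats_map {α : Type*} (l : List α) (f : α → ℕ) :
    encodeNats (l.map f) = l.flatMap fun a => encodeNats [f a] := by
  rw [← encodeNats_flatMap, List.map_eq_flatMap]

theorem finRange_mul_self (n : ℕ) : List.finRange (n * n) =
    (List.finRange n).flatMap fun a => (List.finRange n).map fun b => finProdFinEquiv (a, b) := by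
  rw [← List.ofFn_id, List.ofFn_mul, List.flatMap, ← List.ofFn_eq_map]
  congr 2
  funext a
  rw [← List.ofFn_eq_map]
  congr 1
  funext b
  ext
  simp [finProdFinEquiv, add_comm, mul_comm]

theorem flatMap_finRange_mul_self {α : Type*} (n : ℕ) (f : Fin (n * n) → List α) :
    (List.finRange (n * n)).flatMap f = (List.finRange n).flatMap fun a =>
      (List.finRange n).flatMap fun b => f (finProdFinEquiv (a, b)) := by
  simp only [finRange_mul_self, List.flatMap_assoc, List.flatMap_map]

/-- The bits of a square matrix, row by row. -/
def matrixBits {n : ℕ} (f : Fin n → Fin n → Bool) : List Bool :=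
  (List.finRange n).flatMap fun a => (List.finRange n).map (f a)

@[simp] theorem length_matrixBits {n : ℕ} (f : Fin n → Fin n → Bool) :
    (matrixBits f).length = n * n := by
  simp [matrixBits]

theorem flatMap_matrixBits {n : ℕ} {α : Type*} (f : Fin n → Fin n → Bool) (g : Bool → List α) :
    (matrixBits f).flatMap g = (List.finRange n).flatMap fun a =>
      (List.finRange n).flatMap fun b => g (f a b) := by
  simp [matrixBits, List.flatMap_assoc, List.flatMap_map]

/-- The code of an entry of an adjacency matrix. -/
def bitCode (b : Bool) : List (Option Bool) := if b then [some true, none] else [none]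

theorem encodeNats_singleton_bit (b : Prop) [Decidable b] :
    encodeNats [if b then 1 else 0] = bitCode (decide b) := by
  by_cases h : b <;> simp [h, bitCode] <;> rfl

/-- The code of a pair of voters. -/
def edgeCode (b : Bool) : List (Option Bool) :=
  bitCode b ++ [some true, none, some true, none]

/-- The code of the scores of a voter. -/
def scoreCode (b : Bool) : List (Option Bool) :=
  if b then [none, some false, some true, none] else [some true, none, none]

/-- The rows of the network that belong to the voters `voter a b`, where `a` is fixed. -/
def rowsCode {n : ℕ} (a : Fin n) : List (Option Bool) :=
  (List.finRange n).flatMap fun b => (List.finRange n).flatMap fun c =>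
    (List.finRange n).flatMap fun d =>
      edgeCode (decide (b = a) && (decide (c = a) || decide (d = a)))

/-- The code of the network of the reduction. -/
def networkCode (n : ℕ) : List (Option Bool) := (List.finRange n).flatMap rowsCode

open Classical in
/-- The entries of the adjacency matrix of the graph, row by row. -/
noncomputable def adjBits (I : DkSInstance) : List Bool :=
  matrixBits fun a b => decide (I.G.Adj a b)

theorem encodeDkSInstance_eq (I : DkSInstance) :
    encodeDkSInstance I = (Computability.encodeNat I.n).map some ++ none ::
      ((Computability.encodeNat I.k).map some ++ none :: (adjBits I).flatMap bitCode) := by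
  rw [encodeDkSInstance, List.cons_append, List.singleton_append, encodeNats_cons, encodeNats_cons,
    encodeNats_flatMap, adjBits, flatMap_matrixBits]
  simp only [encodeNats_map, encodeNats_singleton_bit]

section Reduction

variable (I : DkSInstance)

theorem encodeNats_edge (u v : Fin (reduction I).n) :
    encodeNats [if (u, v) ∈ (reduction I).E then 1 else 0, ((reduction I).p (u, v)).num.toNat,
      ((reduction I).p (u, v)).den] = edgeCode (decide ((u, v) ∈ (reduction I).E)) := by
  change encodeNats ([_] ++ [1, 1]) = _
  rw [encodeNats_append, encodeNats_singleton_bit]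
  rfl

theorem flatMap_edgeCode :
    ((List.finRange (reduction I).n).flatMap fun u =>
      (List.finRange (reduction I).n).flatMap fun v =>
        edgeCode (decide ((u, v) ∈ (reduction I).E))) = networkCode I.n := by
  refine (flatMap_finRange_mul_self I.n _).trans ?_
  refine List.flatMap_congr fun a _ => List.flatMap_congr fun b _ => ?_
  refine (flatMap_finRange_mul_self I.n _).trans ?_
  refine List.flatMap_congr fun c _ => List.flatMap_congr fun d _ => ?_
  rw [← Bool.decide_or, ← Bool.decide_and]
  congr 1
  rw [decide_eq_decide]
  refine mem_reduction_E.trans ?_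
  simp only [eq_comm]

open Classical in
theorem encodeNats_scores (a b : Fin I.n) :
    encodeNats ((List.finRange (1 + 1)).map fun i => (reduction I).π (voter a b) i) =
      scoreCode (decide (I.G.Adj a b)) := by
  by_cases h : I.G.Adj a b
  · simp only [reduction_π_of_adj h, h, scoreCode]
    rfl
  · simp only [reduction_π_of_not_adj h, h, scoreCode]
    rfl

theorem flatMap_scoreCode :
    ((List.finRange (reduction I).n).flatMap fun v =>
      encodeNats ((List.finRange (1 + 1)).map fun i => (reduction I).π v i)) =
    (adjBits I).flatMap scoreCode :=
  (flatMap_finRange_mul_self I.n _).trans <| (List.flatMap_congr fun a _ =>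
    List.flatMap_congr fun b _ => encodeNats_scores I a b).trans (flatMap_matrixBits _ _).symm

theorem encodeECSInstance_reduction :
    encodeECSInstance (reduction I) = (Computability.encodeNat (I.n * I.n)).map some ++ none ::
      ((Computability.encodeNat I.k).map some ++ none ::
      (networkCode I.n ++ (adjBits I).flatMap scoreCode)) := by
  rw [encodeECSInstance, List.append_assoc, List.cons_append, List.singleton_append,
    encodeNats_cons, encodeNats_cons, encodeNats_append, encodeNats_flatMap, encodeNats_flatMap]
  simp only [encodeNats_flatMap, encodeNats_edge]
  rw [flatMap_edgeCode, flatMap_scoreCode]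
  rfl

end Reduction

/-- The code of a voter in a seed plan. -/
def seedCode {ℓ : ℕ} : Option (Fin (ℓ + 1) → ℤ) → List (Option Bool)
  | none => [none]
  | some m => [some true, none] ++
      (List.finRange (ℓ + 1)).flatMap fun i => encodeNats [Equiv.intEquivNat (m i)]

theorem encodeSeedPlan_eq {ℓ n : ℕ} (P : SeedPlan ℓ n) :
    encodeSeedPlan ⟨n, P⟩ = (Computability.encodeNat n).map some ++ none ::
      (List.finRange n).flatMap fun s => seedCode (P s) := by
  rw [encodeSeedPlan, encodeNats_cons, encodeNats_flatMap]
  congr 2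
  refine List.flatMap_congr fun s _ => ?_
  cases h : P s with
  | none => simp only [h]; rfl
  | some m =>
    simp only [h, seedCode]
    rw [encodeNats_cons, encodeNats_map]
    rfl

theorem encodeVertexSet_finalSet (P : SeedPlan 1 (reduction I).n) :
    encodeVertexSet ⟨I.n, finalSet P⟩ = (Computability.encodeNat I.n).map some ++ none ::
      (finalBits P).flatMap bitCode := by
  rw [encodeVertexSet, encodeNats_cons, encodeNats_map]
  simp only [encodeNats_singleton_bit]
  congr 2
  conv_rhs => rw [← map_finRange_getD (length_finalBits P), List.flatMap_map]
  refine List.flatMap_congr fun v _ => ?_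
  simp [finalSet]

end ElectionControl

namespace StackProgram

open Function

variable {K : Type} [DecidableEq K] {R : List (Option Bool) → List (Option Bool) → ℕ → Prop}

/-! ### One-hot vectors -/

section Hot

/-- The one-hot vector of length `n` at position `i`, as a string of bits; it marks a vertex in a
loop over all vertices. -/
def hot (n i : ℕ) : List (Option Bool) := (List.finRange n).map fun j => some (decide (j.1 = i))

@[simp] theorem length_hot (n i : ℕ) : (hot n i).length = n := by simp [hot]

theorem hot_succ_zero (n : ℕ) :
    hot (n + 1) 0 = some true :: List.replicate n (some false) := by
  simp [hot, List.finRange_succ, List.eq_replicate_iff]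

theorem cons_dropLast_hot (n i : ℕ) :
    some false :: (hot (n + 1) i).dropLast = hot (n + 1) (i + 1) := by
  apply List.ext_getElem
  · simp [hot]
  · rintro (_ | j) <;> simp [hot]

/-- Pushes the vector `hot n 0` to the stack `h`, where `n` is the length of the stack `u`. -/
def initHot (u t h : K) : Prog K (Option Bool) :=
  each u t (fun _ => .push h (some false)) ;; .branch h fun
    | none => .skip
    | some _ => .pop h ;; .push h (some true)

theorem exec_initHot {u t h : K} (hut : u ≠ t) (huh : u ≠ h) (hth : t ≠ h)
    {s : K → List (Option Bool)} {n : ℕ} (hu : s u = List.replicate n (some true))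
    (ht : s t = []) (hh : s h = []) :
    Exec R (initHot u t h) s (update s h (hot n 0)) (5 * n + 5) := by
  have zeros := exec_each_push (R := R) hut huh hth (g := fun _ => some false) hu ht
  simp only [List.map_replicate, List.reverse_replicate, hh, List.append_nil,
    List.length_replicate] at zeros
  refine (zeros.seq (Exec.branch (t := 2) (s' := update s h (hot n 0)) ?_)).of_eq rfl (by omega)
  cases n with
  | zero => simpa [hot] using (Exec.skip (R := R)).mono one_le_two
  | succ n =>
    simp only [update_self, List.replicate_succ, List.head?_cons]
    exact (Exec.pop.seq Exec.push).of_eq (by simp [hot_succ_zero]) le_rfl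

theorem exec_shift_hot {k t : K} (hkt : k ≠ t) {s : K → List (Option Bool)} {n i : ℕ}
    (hn : n ≠ 0) (hk : s k = hot n i) (ht : s t = []) :
    Exec R (shift (some false) k t) s (update s k (hot n (i + 1))) (4 * n + 4) := by
  obtain ⟨n, rfl⟩ := Nat.exists_eq_succ_of_ne_zero hn
  refine (exec_shift (a := some false) hkt hk ht).of_eq ?_ (by simp)
  rw [Nat.succ_eq_add_one, cons_dropLast_hot]

theorem Emits.each_hot {k t o : K} (hkt : k ≠ t) (hko : k ≠ o) (hto : t ≠ o)
    {P : (K → List (Option Bool)) → Prop} {n i C : ℕ} {f : Fin n → List (Option Bool)}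
    {body : Option Bool → Prog K (Option Bool)}
    (hP : ∀ s a b c, P s → P (update (update (update s o c) k a) t b))
    (hbody : ∀ j : Fin n, Emits R P (body (some (decide (j.1 = i)))) o (f j) C) :
    Emits R (fun s => (s k = hot n i ∧ s t = []) ∧ P s) (StackProgram.each k t body) o
      ((List.finRange n).flatMap f) (n * (C + 4) + 2) :=
  (Emits.each hkt hko hto (fun _ hs => hs.1) (fun s a b c hs => hP s a b c hs.2)
    fun j _ => hbody j).weaken (fun _ hs => hs) (by simp)

end Hot

/-! ### Bilinear forms -/

section Scan

/-- Executed for a row: looks for a common `true` in the stack `y` and in the next row of the matrix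
on the stack `m`, and records it on the stack `acc` if `x` is `true`. The row is moved to the stack
`w`. -/
def scanRow (y ty m w acc : K) (x : Option Bool) : Prog K (Option Bool) :=
  each y ty fun b => .branch m fun
    | none => .skip
    | some e => .pop m ;; .push w e ;;
        if x = some true ∧ b = some true ∧ e = some true then .push acc (some true) else .skip

/-- Looks for an entry `true` of the matrix on the stack `m` whose row is `true` in the stack `x`
and whose column is `true` in the stack `y`, and records it on the stack `acc`. -/
def scan (x tx y ty m w acc : K) : Prog K (Option Bool) :=
  each x tx (scanRow y ty m w acc) ;; move w m

variable {α β : Type*} {l : List α} {l' : List β} {ξ : α → Bool} {η : β → Bool} {σ : α → β → Bool}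
  {s : K → List (Option Bool)}

/-- What `scanRow` records: a `true` for each column that is selected by `η` and in which the row
`τ` has the entry `true`, provided that the row is selected by `a`. -/
def rowHits (l' : List β) (a : Bool) (η τ : β → Bool) : List (Option Bool) :=
  l'.flatMap fun b => if a && η b && τ b then [some true] else []

/-- The string of the entries `σ a b`, row by row. -/
def rowMajor (l : List α) (l' : List β) (σ : α → β → Bool) : List (Option Bool) :=
  l.flatMap fun a => l'.map fun b => some (σ a b)

theorem length_rowMajor (l : List α) (l' : List β) (σ : α → β → Bool) :
    (rowMajor l l' σ).length = l.length * l'.length := by simp [rowMajor]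

/-- The stacks of `scan` after the rows in `l₁`, when the rows in `l₂` remain. -/
def scanStacks (l' : List β) (ξ : α → Bool) (η : β → Bool) (σ : α → β → Bool) (m w acc : K)
    (s : K → List (Option Bool)) (l₁ l₂ : List α) : K → List (Option Bool) :=
  update (update (update s m (rowMajor l₂ l' σ)) w (rowMajor l₁ l' σ).reverse) acc
    ((l₁.flatMap fun a => rowHits l' (ξ a) η (σ a)).reverse ++ s acc)

theorem exec_scanRow {y ty m w acc : K} (hnd : [y, ty, m, w, acc].Nodup) {a : Bool} {τ : β → Bool}
    {r : List (Option Bool)} (hy : s y = l'.map fun b => some (η b)) (hty : s ty = [])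
    (hm : s m = (l'.map fun b => some (τ b)) ++ r) :
    Exec R (scanRow y ty m w acc (some a)) s
      (update (update (update s m r) w ((l'.map fun b => some (τ b)).reverse ++ s w)) acc
        ((rowHits l' a η τ).reverse ++ s acc)) (l'.length * 8 + 2) := by
  simp only [List.nodup_cons, List.mem_cons, List.not_mem_nil, or_false, not_or,
    List.nodup_nil, and_true, not_false_eq_true] at hnd
  obtain ⟨⟨y_ty, y_m, y_w, y_acc⟩, ⟨ty_m, ty_w, ty_acc⟩, ⟨m_w, m_acc⟩, w_acc⟩ := hnd
  refine exec_each (ξ := fun b => some (η b)) (l := l') (C := 4) (S := fun l₁ l₂ =>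
    update (update (update s m ((l₂.map fun b => some (τ b)) ++ r)) w
      ((l₁.map fun b => some (τ b)).reverse ++ s w)) acc ((rowHits l₁ a η τ).reverse ++ s acc))
    y_ty ?_ rfl hy hty (by simpa [y_m, y_w, y_acc] using hy)
    (by simpa [ty_m, ty_w, ty_acc] using hty) ?_
  · simp [rowHits, ← hm]
  · intro l₁ b l₂ _ p q
    refine Exec.branch (t := 3) ?_
    simp only [ne_eq, Ne.symm ty_m, Ne.symm y_m, m_w, m_acc, not_false_eq_true, update_of_ne,
      update_self, List.map_cons, List.cons_append, List.head?_cons]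
    by_cases h : a = true ∧ η b = true ∧ τ b = true
    · rw [if_pos (by simpa using h)]
      refine (Exec.pop.seq (Exec.push.seq Exec.push)).of_eq ?_ le_rfl
      funext j
      simp only [update_apply, rowHits, List.flatMap_append, List.map_append]
      grind
    · rw [if_neg (by simpa using h)]
      refine (Exec.pop.seq (Exec.push.seq Exec.skip)).of_eq ?_ le_rfl
      funext j
      simp only [update_apply, rowHits, List.flatMap_append, List.map_append]
      grind

variable {x tx y ty m w acc : K}

theorem exec_each_scanRow (hnd : [x, tx, y, ty, m, w, acc].Nodup)
    (hx : s x = l.map fun a => some (ξ a)) (htx : s tx = [])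
    (hy : s y = l'.map fun b => some (η b)) (hty : s ty = []) :
    Exec R (each x tx (scanRow y ty m w acc)) (scanStacks l' ξ η σ m w acc s [] l)
      (scanStacks l' ξ η σ m w acc s l []) (l.length * (l'.length * 8 + 6) + 2) := by
  have hnd' : [y, ty, m, w, acc].Nodup := (List.nodup_cons.1 (List.nodup_cons.1 hnd).2).2
  refine exec_each (body := scanRow y ty m w acc) (ξ := fun a => some (ξ a)) (l := l)
    (C := l'.length * 8 + 2) (S := scanStacks l' ξ η σ m w acc s) (by grind) rfl rfl
    (by simp only [scanStacks, update_apply]; grind)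
    (by simp only [scanStacks, update_apply]; grind)
    (by simp only [scanStacks, update_apply]; grind)
    (by simp only [scanStacks, update_apply]; grind) ?_
  intro l₁ a l₂ _ p q
  refine (exec_scanRow hnd' (l' := l') (η := η) (τ := σ a) (a := ξ a) (r := rowMajor l₂ l' σ)
    ?_ ?_ ?_).of_eq ?_ le_rfl
  · simp only [scanStacks, update_apply]
    grind
  · simp only [scanStacks, update_apply]
    grind
  · simp only [scanStacks, update_apply, rowMajor]
    grind
  · funext j
    simp only [scanStacks, update_apply, rowMajor, List.flatMap_append]
    grind

theorem exec_scan (hnd : [x, tx, y, ty, m, w, acc].Nodup)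
    (hx : s x = l.map fun a => some (ξ a)) (htx : s tx = [])
    (hy : s y = l'.map fun b => some (η b)) (hty : s ty = [])
    (hm : s m = rowMajor l l' σ) (hw : s w = []) :
    Exec R (scan x tx y ty m w acc) s
      (update s acc ((l.flatMap fun a => rowHits l' (ξ a) η (σ a)).reverse ++ s acc))
      (l.length * (10 * l'.length + 6) + 3) := by
  have rows := exec_each_scanRow (R := R) (σ := σ) hnd hx htx hy hty
  have hwm : w ≠ m := by grind
  have restore := exec_move (R := R) hwm (x := (rowMajor l l' σ).reverse)
    (s := scanStacks l' ξ η σ m w acc s l []) (by simp only [scanStacks, update_apply]; grind)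
  refine ((rows.of_start_eq ?_).seq restore).of_eq ?_ ?_
  · funext j
    simp only [scanStacks, update_apply, rowMajor, List.flatMap_nil]
    grind [rowMajor]
  · funext j
    simp only [scanStacks, update_apply, rowMajor, List.flatMap_nil]
    grind [rowMajor]
  · rw [List.length_reverse, length_rowMajor]
    exact le_of_eq (by ring)

/-- Pushes whether something has been recorded on the stack `acc`, and empties it. -/
def flush (acc o : K) : Prog K (Option Bool) :=
  .branch acc (fun
    | none => .push o (some false)
    | some _ => .push o (some true)) ;; clear acc

theorem exec_flush (h : acc ≠ w) {z : List (Option Bool)} (hz : s acc = z) :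
    Exec R (flush acc w) s (update (update s acc []) w (some (decide (z ≠ [])) :: s w))
      (2 * z.length + 3) := by
  have record : Exec R (.branch acc (fun
    | none => .push w (some false)
    | some _ => .push w (some true))) s (update s w (some (decide (z ≠ [])) :: s w)) 2 := by
    refine Exec.branch (t := 1) ?_
    rw [hz]
    cases z <;> simpa using Exec.push (R := R) (k := w)
  exact (record.seq (exec_clear (x := z) (by simpa [h] using hz))).of_eq (update_comm h.symm _ _ _)
    (by omega)

end Scan

end StackProgram

namespace ElectionControl

open StackProgram Computability Function

variable {R : List (Option Bool) → List (Option Bool) → ℕ → Prop}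

/-! ### The reduction as a program -/

/-- The stacks of the algorithm. -/
inductive Stack
  | inp | nR | kR | adj | bits | cnt | u | uk | h1 | h2 | h3 | out | res
  | ctl | tmp | t0 | t1 | t2 | t3 | acc
  deriving DecidableEq

instance : Fintype Stack :=
  ⟨{.inp, .nR, .kR, .adj, .bits, .cnt, .u, .uk, .h1, .h2, .h3, .out, .res, .ctl, .tmp, .t0, .t1,
    .t2, .t3, .acc}, fun j => by cases j <;> decide⟩

/-- A content of the stacks in which the auxiliary stacks `ctl`, `tmp`, `t0`, …, `t3`, `acc` are
empty. Between the steps of the algorithm `nR` and `kR` hold the numbers `n` and `k` in binary, with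
the most significant bit on top, `u` and `uk` hold them in unary, and `h1`, `h2`, `h3` are one-hot
vectors. -/
structure Store where
  inp : List (Option Bool) := []
  nR : List (Option Bool) := []
  kR : List (Option Bool) := []
  adj : List (Option Bool) := []
  bits : List (Option Bool) := []
  cnt : List (Option Bool) := []
  u : List (Option Bool) := []
  uk : List (Option Bool) := []
  h1 : List (Option Bool) := []
  h2 : List (Option Bool) := []
  h3 : List (Option Bool) := []
  out : List (Option Bool) := []
  res : List (Option Bool) := []

/-- The content of the stacks as a function. -/
def Store.fn (m : Store) : Stack → List (Option Bool)
  | .inp => m.inp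
  | .nR => m.nR
  | .kR => m.kR
  | .adj => m.adj
  | .bits => m.bits
  | .cnt => m.cnt
  | .u => m.u
  | .uk => m.uk
  | .h1 => m.h1
  | .h2 => m.h2
  | .h3 => m.h3
  | .out => m.out
  | .res => m.res
  | _ => []

/-- Reads the adjacency matrix. -/
def readMatrix : Prog Stack (Option Bool) :=
  .loop .inp fun
    | none => .push .adj (some false)
    | some _ => .pop .inp ;; .push .adj (some true)

theorem exec_readMatrix (l : List Bool) (m : Store) (h : m.inp = l.flatMap bitCode) :
    Exec R readMatrix m.fn {m with inp := [], adj := (l.map some).reverse ++ m.adj}.fn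
      (3 * l.length + 1) := by
  have loop := exec_loop (R := R) (k := Stack.inp) (l := l) (C := 2)
    (body := fun
      | none => .push .adj (some false)
      | some _ => .pop .inp ;; .push .adj (some true))
    (S := fun l₁ l₂ =>
      {m with inp := l₂.flatMap bitCode, adj := (l₁.map some).reverse ++ m.adj}.fn) rfl ?_
  · exact (loop.of_start_eq (by simp [← h])).mono (by omega)
  rintro l₁ (_ | _) l₂ -
  · refine ⟨none, l₂.flatMap bitCode, rfl, Exec.push.of_eq ?_ one_le_two⟩
    funext j
    cases j <;> simp [Store.fn]
  · refine ⟨some true, none :: l₂.flatMap bitCode, rfl, (Exec.pop.seq Exec.push).of_eq ?_ le_rfl⟩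
    funext j
    cases j <;> simp [Store.fn]

/-- Reverses the list of matrix entries and counts them. -/
def countEntries : Prog Stack (Option Bool) :=
  .loop .adj fun x => .push .bits x ;; increment .cnt .tmp .ctl

theorem exec_countEntries (l : List (Option Bool)) (m : Store) (h : m.adj = l)
    (hc : m.cnt = []) :
    Exec R countEntries m.fn {m with
      adj := [], bits := l.reverse ++ m.bits, cnt := (encodeNat l.length).map some}.fn
      (l.length * (7 * l.length + 9) + 1) := by
  have loop := exec_loop (R := R) (k := Stack.adj) (l := l) (C := 7 * l.length + 8)
    (body := fun x => .push .bits x ;; increment .cnt .tmp .ctl)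
    (S := fun l₁ l₂ => {m with
      adj := l₂, bits := l₁.reverse ++ m.bits, cnt := (encodeNat l₁.length).map some}.fn) rfl ?_
  · have zero_bits : encodeNat 0 = [] := rfl
    refine loop.of_start_eq ?_
    funext j
    cases j <;> simp [Store.fn, h, hc, zero_bits]
  · intro l₁ x l₂ hl
    have bound : (encodeNat l₁.length).length ≤ l.length :=
      (length_encodeNat_le _).trans (by simp [hl])
    have inc := exec_increment (R := R) (k := Stack.cnt) (t := .tmp) (c := .ctl)
      (s := {m with
        adj := l₂, bits := x :: (l₁.reverse ++ m.bits), cnt := (encodeNat l₁.length).map some}.fn)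
      (l := encodeNat l₁.length) (by decide) (by decide) (by decide) rfl rfl rfl
    refine ⟨x, l₂, rfl, (Exec.push.seq (inc.of_start_eq ?_)).of_eq ?_ (by omega)⟩
    · funext j
      cases j <;> simp [Store.fn]
    · funext j
      cases j <;> simp [Store.fn, encodeNat_succ]

/-- Writes the rows of the network that belong to one vertex. -/
def writeRows : Prog Stack (Option Bool) :=
  each .h1 .t1 fun x => each .h2 .t2 fun y => each .h3 .t3 fun z =>
    pushAll .out (edgeCode (decide (x = some true) &&
      (decide (y = some true) || decide (z = some true))))

theorem length_edgeCode_le (b : Bool) : (edgeCode b).length ≤ 6 := by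
  cases b <;> simp [edgeCode, bitCode]

theorem emits_writeRows {n : ℕ} (a : Fin n) :
    Emits R (fun s : Stack → List (Option Bool) => (s .h1 = hot n a ∧ s .t1 = []) ∧
        (s .h2 = hot n a ∧ s .t2 = []) ∧ (s .h3 = hot n a ∧ s .t3 = []) ∧ True)
      writeRows .out (rowsCode a) (n * (n * (n * 11 + 6) + 6) + 2) := by
  refine Emits.each_hot (by decide) (by decide) (by decide) (by simp) fun b =>
    Emits.each_hot (by decide) (by decide) (by decide) (by simp) fun c =>
      Emits.each_hot (C := 7) (by decide) (by decide) (by decide) (by simp) fun d => ?_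
  simp only [Option.some.injEq, decide_eq_true_eq, ← Fin.ext_iff]
  exact (emits_pushAll _).weaken (fun _ h => h) (Nat.succ_le_succ (length_edgeCode_le _))

/-- Writes the network. -/
def writeNetwork : Prog Stack (Option Bool) :=
  each .u .t0 fun _ => writeRows ;; shift (some false) .h1 .t1 ;; shift (some false) .h2 .t2 ;;
    shift (some false) .h3 .t3

theorem length_of_finRange_eq_append_cons {n : ℕ} {l₁ l₂ : List (Fin n)} {a : Fin n}
    (h : List.finRange n = l₁ ++ a :: l₂) : l₁.length = a.1 := by
  have := congrArg (·[l₁.length]?) h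
  grind

theorem exec_writeNetwork (n : ℕ) (m : Store) (hu : m.u = List.replicate n (some true))
    (h₁ : m.h1 = hot n 0) (h₂ : m.h2 = hot n 0) (h₃ : m.h3 = hot n 0) :
    Exec R writeNetwork m.fn {m with
      h1 := hot n n, h2 := hot n n, h3 := hot n n, out := (networkCode n).reverse ++ m.out}.fn
      (n * (n * (n * (n * 11 + 6) + 6) + 12 * n + 18) + 2) := by
  refine (exec_each (ξ := fun _ => some true) (l := List.finRange n)
    (C := n * (n * (n * 11 + 6) + 6) + 12 * n + 14)
    (S := fun l₁ _ => {m with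
      h1 := hot n l₁.length, h2 := hot n l₁.length, h3 := hot n l₁.length,
      out := (l₁.flatMap rowsCode).reverse ++ m.out}.fn)
    (by decide) ?_ ?_ ?_ rfl ?_ rfl ?_).mono (by simp)
  · funext j
    cases j <;> simp [Store.fn, h₁, h₂, h₃]
  · funext j
    cases j <;> simp [Store.fn, networkCode]
  · simpa [Store.fn] using hu
  · simpa [Store.fn] using hu
  · intro l₁ a l₂ hl x y
    have hn : n ≠ 0 := Nat.ne_zero_of_lt a.2
    rw [List.length_append, length_of_finRange_eq_append_cons hl]
    have rows := emits_writeRows (R := R) a (update (update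
      {m with
        h1 := hot n a.1, h2 := hot n a.1, h3 := hot n a.1,
        out := (l₁.flatMap rowsCode).reverse ++ m.out}.fn .u x) .t0 y) (by simp [Store.fn])
    refine (rows.seq ((exec_shift_hot (by decide) hn (i := a) ?_ ?_).seq
      ((exec_shift_hot (by decide) hn (i := a) ?_ ?_).seq
        (exec_shift_hot (by decide) hn (i := a) ?_ ?_)))).of_eq ?_ (by omega)
    iterate 6 simp [Store.fn]
    funext j
    cases j <;> simp [Store.fn]

/-- Writes the scores of the voters. -/
def writeScores : Prog Stack (Option Bool) :=
  .loop .bits fun x => pushAll .out (scoreCode (decide (x = some true)))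

theorem length_scoreCode_le (b : Bool) : (scoreCode b).length ≤ 4 := by
  cases b <;> simp [scoreCode]

theorem exec_writeScores (l : List Bool) (m : Store) (h : m.bits = l.map some) :
    Exec R writeScores m.fn {m with bits := [], out := (l.flatMap scoreCode).reverse ++ m.out}.fn
      (6 * l.length + 1) := by
  have loop := exec_loop (R := R) (k := Stack.bits) (l := l) (C := 5)
    (body := fun x => pushAll .out (scoreCode (decide (x = some true))))
    (S := fun l₁ l₂ =>
      {m with bits := l₂.map some, out := (l₁.flatMap scoreCode).reverse ++ m.out}.fn) rfl ?_
  · exact (loop.of_start_eq (by simp [← h])).mono (by omega)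
  · intro l₁ b l₂ _
    refine ⟨some b, l₂.map some, rfl, (emits_pushAll _ _ trivial).of_eq ?_
      (Nat.succ_le_succ (length_scoreCode_le _))⟩
    funext j
    cases j <;> simp [Store.fn]

end ElectionControl

namespace ElectionControl

open StackProgram Computability Function

variable {R : List (Option Bool) → List (Option Bool) → ℕ → Prop}

section ReadGraph

/-- Reads the code of a graph and counts the entries of its adjacency matrix. -/
def readGraph : Prog Stack (Option Bool) :=
  readNum .inp .nR .ctl ;; readNum .inp .kR .ctl ;; readMatrix ;; countEntries

/-- The stacks after `readGraph`. -/
noncomputable def graphStore (I : DkSInstance) : Store where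
  nR := ((encodeNat I.n).map some).reverse
  kR := ((encodeNat I.k).map some).reverse
  bits := (adjBits I).map some
  cnt := (encodeNat (I.n * I.n)).map some

theorem length_adjBits (I : DkSInstance) : (adjBits I).length = I.n * I.n := length_matrixBits _

theorem exec_readGraph (I : DkSInstance) :
    Exec R readGraph {inp := encodeDkSInstance I : Store}.fn (graphStore I).fn
      (5 * I.n + 5 + (5 * I.n + 5 + (3 * (I.n * I.n) + 1 +
        (I.n * I.n * (7 * (I.n * I.n) + 9) + 1)))) := by
  have len_n := length_encodeNat_le I.n
  have len_k := (length_encodeNat_le I.k).trans I.k_le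
  let afterN : Store :=
    { nR := ((encodeNat I.n).map some).reverse
      inp := (encodeNat I.k).map some ++ none :: (adjBits I).flatMap bitCode }
  let afterK : Store :=
    { afterN with
      kR := ((encodeNat I.k).map some).reverse
      inp := (adjBits I).flatMap bitCode }
  have readN : Exec R (readNum .inp .nR .ctl) {inp := encodeDkSInstance I : Store}.fn afterN.fn
      (5 * I.n + 5) := by
    refine Exec.of_eq (exec_readNum (by decide) (by decide) (by decide)
      (encodeDkSInstance_eq I) rfl) ?_ (by omega)
    funext j
    cases j <;> simp [Store.fn, afterN]
  have readK : Exec R (readNum .inp .kR .ctl) afterN.fn afterK.fn (5 * I.n + 5) := by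
    refine Exec.of_eq (exec_readNum (l := encodeNat I.k) (by decide) (by decide) (by decide)
      rfl rfl) ?_ (by omega)
    funext j
    cases j <;> simp [Store.fn, afterN, afterK]
  have readAdj := exec_readMatrix (R := R) (adjBits I) afterK rfl
  have count := exec_countEntries (R := R) _ { afterK with
    inp := [], adj := ((adjBits I).map some).reverse ++ afterK.adj } rfl rfl
  refine (readN.seq (readK.seq (readAdj.seq count))).of_eq ?_
    (by simp [afterN, afterK, length_adjBits])
  simp [graphStore, afterN, afterK, length_adjBits]

end ReadGraph

section InitCounters

/-- Computes `n` and `k` in unary and initializes the one-hot vectors. -/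
def initCounters : Prog Stack (Option Bool) :=
  toUnary .nR .t0 .u .tmp ;; toUnary .kR .t0 .uk .tmp ;;
  initHot .u .t0 .h1 ;; initHot .u .t0 .h2 ;; initHot .u .t0 .h3

theorem exec_initCounters {n k : ℕ} (hkn : k ≤ n) (m : Store)
    (hn : m.nR = ((encodeNat n).map some).reverse) (hk : m.kR = ((encodeNat k).map some).reverse)
    (hu : m.u = []) (huk : m.uk = []) (h₁ : m.h1 = []) (h₂ : m.h2 = []) (h₃ : m.h3 = []) :
    Exec R initCounters m.fn { m with
      u := List.replicate n (some true), uk := List.replicate k (some true),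
      h1 := hot n 0, h2 := hot n 0, h3 := hot n 0 }.fn
      (n * (7 * n + 7) + 2 + (n * (7 * n + 7) + 2 + (5 * n + 5 + (5 * n + 5 + (5 * n + 5))))) := by
  have unaryN := exec_toUnary_encodeNat (R := R) (k := Stack.nR) (t := .t0) (u := .u) (v := .tmp)
    (s := m.fn) (by decide) (by decide) (by decide) (by decide) (by decide) (by decide)
    hn rfl hu rfl
  have unaryK := (exec_toUnary_encodeNat (R := R) (k := Stack.kR) (t := .t0) (u := .uk) (v := .tmp)
    (s := update m.fn .u (List.replicate n (some true)))
    (by decide) (by decide) (by decide) (by decide) (by decide) (by decide)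
    hk rfl huk rfl).mono (t' := n * (7 * n + 7) + 2) (by gcongr)
  have init (h : Stack) (hh : h ∉ [.u, .t0]) (s : Stack → List (Option Bool))
      (hu : s .u = List.replicate n (some true)) (ht : s .t0 = []) (hs : s h = []) :
      Exec R (initHot .u .t0 h) s (update s h (hot n 0)) (5 * n + 5) :=
    exec_initHot (by decide) (by grind) (by grind) hu ht hs
  refine (unaryN.seq (unaryK.seq ((init .h1 (by decide) _ rfl rfl h₁).seq
    ((init .h2 (by decide) _ rfl rfl h₂).seq (init .h3 (by decide) _ rfl rfl h₃))))).of_eq ?_ le_rfl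
  funext j
  cases j <;> simp [Store.fn]

end InitCounters

section WriteElection

/-- Writes the numbers of voters and the budget. -/
def writeHeader : Prog Stack (Option Bool) :=
  move .cnt .out ;; .push .out none ;; move .kR .res ;; move .res .out ;; .push .out none

theorem exec_writeHeader {a b : List (Option Bool)} {A B : ℕ} (m : Store) (ha : m.cnt = a)
    (hb : m.kR = b) (hA : a.length ≤ A) (hB : b.length ≤ B) (hr : m.res = []) :
    Exec R writeHeader m.fn
      { m with cnt := [], kR := [], out := none :: (b ++ none :: (a.reverse ++ m.out)) }.fn
      (2 * A + 1 + (1 + (2 * B + 1 + (2 * B + 1 + 1)))) := by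
  have writeA := exec_move (R := R) (a := Stack.cnt) (b := .out) (s := m.fn) (by decide) ha
  have moveB := exec_move (R := R) (a := Stack.kR) (b := .res)
    (s := { m with cnt := [], out := none :: (a.reverse ++ m.out) }.fn) (by decide) hb
  have writeB := exec_move (R := R) (a := Stack.res) (b := .out) (x := b.reverse)
    (s := { m with
      cnt := [], kR := [], res := b.reverse, out := none :: (a.reverse ++ m.out) }.fn)
    (by decide) rfl
  refine (writeA.seq (Exec.push.seq ((moveB.of_start_eq ?_).seq
    ((writeB.of_start_eq ?_).seq Exec.push)))).of_eq ?_
    (by simp only [List.length_reverse]; omega)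
  all_goals
    funext j
    cases j <;> simp [Store.fn, hr]

/-- Writes the voters and discards the one-hot vectors. -/
def writeVoters : Prog Stack (Option Bool) :=
  writeNetwork ;; writeScores ;; clear .h1 ;; clear .h2 ;; clear .h3

theorem exec_writeVoters {n : ℕ} {l : List Bool} (m : Store)
    (hu : m.u = List.replicate n (some true)) (h₁ : m.h1 = hot n 0) (h₂ : m.h2 = hot n 0)
    (h₃ : m.h3 = hot n 0) (hl : m.bits = l.map some) :
    Exec R writeVoters m.fn { m with
      bits := [], h1 := [], h2 := [], h3 := [],
      out := (networkCode n ++ l.flatMap scoreCode).reverse ++ m.out }.fn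
      (n * (n * (n * (n * 11 + 6) + 6) + 12 * n + 18) + 2 + (6 * l.length + 1 +
        (2 * n + 1 + (2 * n + 1 + (2 * n + 1))))) := by
  have network := exec_writeNetwork (R := R) n m hu h₁ h₂ h₃
  have scores := exec_writeScores (R := R) l { m with
    h1 := hot n n, h2 := hot n n, h3 := hot n n, out := (networkCode n).reverse ++ m.out } hl
  have clearHot (h : Stack) (s : Stack → List (Option Bool)) (hs : s h = hot n n) :
      Exec R (clear h) s (update s h []) (2 * n + 1) := (exec_clear hs).mono (by simp)
  refine (network.seq (scores.seq ((clearHot .h1 _ rfl).seq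
    ((clearHot .h2 _ rfl).seq (clearHot .h3 _ rfl))))).of_eq ?_ le_rfl
  funext j
  cases j <;> simp [Store.fn]

end WriteElection

section ReductionProg

/-- Turns the code of a graph on the stack `inp` into the code of an election on the stack `out`. -/
def reductionProg : Prog Stack (Option Bool) :=
  readGraph ;; initCounters ;; writeHeader ;; writeVoters

/-- The running time of `reductionProg`, in any semiring: it is evaluated in `ℕ` and in `ℕ[X]`. -/
def reductionTime {A : Type*} [CommSemiring A] (n : A) : A :=
  5 * n + 5 + (5 * n + 5 + (3 * (n * n) + 1 + (n * n * (7 * (n * n) + 9) + 1))) +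
  (n * (7 * n + 7) + 2 + (n * (7 * n + 7) + 2 + (5 * n + 5 + (5 * n + 5 + (5 * n + 5)))) +
  (2 * (n * n) + 1 + (1 + (2 * n + 1 + (2 * n + 1 + 1))) +
  (n * (n * (n * (n * 11 + 6) + 6) + 12 * n + 18) + 2 + (6 * (n * n) + 1 +
    (2 * n + 1 + (2 * n + 1 + (2 * n + 1)))))))

theorem exec_reductionProg (I : DkSInstance) :
    Exec R reductionProg {inp := encodeDkSInstance I : Store}.fn
      { nR := ((encodeNat I.n).map some).reverse
        u := List.replicate I.n (some true)
        uk := List.replicate I.k (some true)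
        out := (encodeECSInstance (reduction I)).reverse : Store }.fn (reductionTime I.n) := by
  let counters : Store := { graphStore I with
    u := List.replicate I.n (some true), uk := List.replicate I.k (some true),
    h1 := hot I.n 0, h2 := hot I.n 0, h3 := hot I.n 0 }
  have init := exec_initCounters (R := R) I.k_le (graphStore I) rfl rfl rfl rfl rfl rfl rfl
  have header := exec_writeHeader (R := R) (A := I.n * I.n) (B := I.n) counters rfl rfl
    (by simpa [counters, graphStore] using length_encodeNat_le _)
    (by simpa [counters, graphStore] using (length_encodeNat_le _).trans I.k_le) rfl
  have voters := exec_writeVoters (R := R) (n := I.n) (l := adjBits I) { counters with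
    cnt := [], kR := [],
    out := none :: (counters.kR ++ none :: (counters.cnt.reverse ++ counters.out)) }
    rfl rfl rfl rfl rfl
  refine ((exec_readGraph I).seq (init.seq (header.seq voters))).of_eq ?_
    (by rw [length_adjBits]; rfl)
  simp [counters, graphStore, encodeECSInstance_reduction]

end ReductionProg

end ElectionControl

namespace ElectionControl

open StackProgram Computability Function

variable {R : List (Option Bool) → List (Option Bool) → ℕ → Prop}

/-! ### From a seed plan to a set of vertices -/

section ReadPlan

/-- Reads a number and forgets it. -/
def skipNum : Prog Stack (Option Bool) := readNum .inp .tmp .ctl ;; clear .tmp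

theorem exec_skipNum (l : List Bool) (r : List (Option Bool)) (m : Store)
    (h : m.inp = l.map some ++ none :: r) :
    Exec R skipNum m.fn { m with inp := r }.fn (7 * l.length + 6) := by
  have read := exec_readNum (R := R) (i := Stack.inp) (o := .tmp) (c := .ctl) (s := m.fn)
    (by decide) (by decide) (by decide) h rfl
  refine (read.seq (exec_clear (x := (l.map some).reverse) (by simp [Store.fn]))).of_eq ?_ ?_
  · funext j
    cases j <;> simp [Store.fn]
  · simp only [List.length_reverse, List.length_map]
    omega

/-- Reads the code of a voter in a seed plan whose first symbol is given. -/
def readSeed : Option Bool → Prog Stack (Option Bool)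
  | none => .push .adj (some false)
  | some _ => .pop .inp ;; skipNum ;; skipNum ;; .push .adj (some true)

theorem exec_readSeed_some (μ : Fin (1 + 1) → ℤ) (r : List (Option Bool)) (m : Store) (s : Bool)
    (h : m.inp = (seedCode (some μ)).tail ++ r)
    (hμ : ∀ i, (encodeNat (Equiv.intEquivNat (μ i))).length ≤ 2) :
    Exec R (readSeed (some s)) m.fn { m with inp := r, adj := some true :: m.adj }.fn 42 := by
  let code (i : Fin (1 + 1)) : List (Option Bool) :=
    (encodeNat (Equiv.intEquivNat (μ i))).map some
  have inp_eq : m.inp = none :: (code 0 ++ none :: (code 1 ++ none :: r)) := by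
    simp [h, seedCode, List.finRange_succ, encodeNats_cons, encodeNats_nil, code]
  have skip₀ := exec_skipNum (R := R) _ (code 1 ++ none :: r)
    { m with inp := code 0 ++ none :: (code 1 ++ none :: r) } rfl
  have skip₁ := exec_skipNum (R := R) _ r { m with inp := code 1 ++ none :: r } rfl
  have len₀ := hμ 0
  have len₁ := hμ 1
  refine (Exec.pop.seq ((skip₀.of_start_eq ?_).seq (skip₁.seq Exec.push))).of_eq ?_ (by omega)
  · funext j
    cases j <;> simp [Store.fn, inp_eq]
  · funext j
    cases j <;> simp [Store.fn]

/-- Reads the codes of the voters in a seed plan and records which of them are seeds. -/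
def readPlan : Prog Stack (Option Bool) := .loop .inp readSeed

theorem exec_readPlan (l : List (Option (Fin (1 + 1) → ℤ))) (m : Store)
    (h : m.inp = l.flatMap seedCode)
    (hl : ∀ μ, some μ ∈ l → ∀ i, (encodeNat (Equiv.intEquivNat (μ i))).length ≤ 2) :
    Exec R readPlan m.fn
      { m with inp := [], adj := (l.map fun o => some (Option.isSome o)).reverse ++ m.adj }.fn
      (43 * l.length + 1) := by
  have loop := exec_loop (R := R) (k := Stack.inp) (l := l) (C := 42) (body := readSeed)
    (S := fun l₁ l₂ => { m with
      inp := l₂.flatMap seedCode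
      adj := (l₁.map fun o => some (Option.isSome o)).reverse ++ m.adj }.fn) rfl ?_
  · exact (loop.of_start_eq (by simp [← h])).mono (by omega)
  rintro l₁ (_ | μ) l₂ hl₁₂
  · refine ⟨none, l₂.flatMap seedCode, rfl, Exec.of_eq Exec.push ?_ (by norm_num)⟩
    funext j
    cases j <;> simp [Store.fn]
  · have read := exec_readSeed_some (R := R) μ (l₂.flatMap seedCode) { m with
      inp := (seedCode (some μ)).tail ++ l₂.flatMap seedCode
      adj := (l₁.map fun o => some (Option.isSome o)).reverse ++ m.adj } true rfl
      (hl μ (by simp [hl₁₂]))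
    refine ⟨some true, (seedCode (some μ)).tail ++ l₂.flatMap seedCode, rfl,
      (read.of_start_eq ?_).of_eq ?_ le_rfl⟩
    · funext j
      cases j <;> simp [Store.fn]
    · simp

end ReadPlan

section Hits

variable {n : ℕ}

/-- The hits of `scan` in a square matrix. -/
def hits (ξ η : Fin n → Bool) (f : Fin n → Fin n → Bool) : List (Option Bool) :=
  (List.finRange n).flatMap fun a => rowHits (List.finRange n) (ξ a) η (f a)

theorem hits_ne_nil {ξ η : Fin n → Bool} {f : Fin n → Fin n → Bool} :
    hits ξ η f ≠ [] ↔ ∃ a b, ξ a ∧ η b ∧ f a b := by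
  simp only [hits, rowHits, ne_eq, List.flatMap_eq_nil_iff, List.mem_finRange, true_implies]
  push Not
  refine exists_congr fun a => exists_congr fun b => ?_
  split_ifs with h <;> simp_all

theorem length_flatMap_le {α β : Type*} {l : List α} {f : α → List β} {C : ℕ}
    (h : ∀ a ∈ l, (f a).length ≤ C) : (l.flatMap f).length ≤ l.length * C := by
  rw [List.length_flatMap]
  exact (List.sum_le_card_nsmul _ C (by simpa using h)).trans (by simp)

theorem length_hits_le (ξ η : Fin n → Bool) (f : Fin n → Fin n → Bool) :
    (hits ξ η f).length ≤ n * n := by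
  have row (a : Fin n) : (rowHits (List.finRange n) (ξ a) η (f a)).length ≤ n :=
    (length_flatMap_le (C := 1) fun b _ => by split_ifs <;> simp).trans (by simp)
  exact (length_flatMap_le fun a _ => row a).trans (by simp)

theorem map_some_matrixBits (f : Fin n → Fin n → Bool) :
    (matrixBits f).map some = rowMajor (List.finRange n) (List.finRange n) f := by
  simp [matrixBits, rowMajor, List.map_flatMap, Function.comp_def]

theorem exec_scan_matrix {x tx y ty m w z : Stack} (hnd : [x, tx, y, ty, m, w, z].Nodup)
    {ξ η : Fin n → Bool} {f : Fin n → Fin n → Bool} {s : Stack → List (Option Bool)}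
    (hx : s x = (List.finRange n).map fun a => some (ξ a)) (htx : s tx = [])
    (hy : s y = (List.finRange n).map fun b => some (η b)) (hty : s ty = [])
    (hm : s m = (matrixBits f).map some) (hw : s w = []) :
    Exec R (scan x tx y ty m w z) s (update s z ((hits ξ η f).reverse ++ s z))
      (n * (10 * n + 6) + 3) :=
  (exec_scan hnd hx htx hy hty (hm.trans (map_some_matrixBits f)) hw).mono (by simp)

end Hits

section Diagonal

/-- Records the diagonal entry of the matrix on the stack `bits` that the one-hot vectors select,
and moves on to the next one. -/
def diagonalEntry : Prog Stack (Option Bool) :=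
  scan .h1 .t1 .h2 .t2 .bits .adj .acc ;; flush .acc .res ;;
    shift (some false) .h1 .t1 ;; shift (some false) .h2 .t2

theorem exec_diagonalEntry {n : ℕ} (f : Fin n → Fin n → Bool) (a : Fin n) (m : Store)
    (h₁ : m.h1 = hot n a) (h₂ : m.h2 = hot n a) (hb : m.bits = (matrixBits f).map some)
    (ha : m.adj = []) (x y : List (Option Bool)) :
    Exec R diagonalEntry (update (update m.fn .u x) .t0 y)
      (update (update { m with
        h1 := hot n (a + 1), h2 := hot n (a + 1), res := some (f a a) :: m.res }.fn .u x) .t0 y)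
      (n * (10 * n + 6) + 2 * (n * n) + 8 * n + 14) := by
  let δ : Fin n → Bool := fun j => decide (j.1 = a.1)
  have hn : n ≠ 0 := a.pos.ne'
  have entry : decide ((hits δ δ f).reverse ≠ []) = f a a := by
    rw [Bool.eq_iff_iff, decide_eq_true_iff, List.reverse_ne_nil_iff, hits_ne_nil]
    simp [δ, ← Fin.ext_iff]
  have len := length_hits_le δ δ f
  refine Exec.of_eq ((exec_scan_matrix (ξ := δ) (η := δ) (f := f) (by decide)
      (by simp [Store.fn, h₁, hot, δ]) (by simp [Store.fn]) (by simp [Store.fn, h₂, hot, δ])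
      (by simp [Store.fn]) (by simp [Store.fn, hb]) (by simp [Store.fn, ha])).seq
    ((exec_flush (z := (hits δ δ f).reverse) (by decide) (by simp [Store.fn])).seq
    ((exec_shift_hot (i := a) (by decide) hn (by simp [Store.fn, h₁]) (by simp [Store.fn])).seq
    (exec_shift_hot (i := a) (by decide) hn (by simp [Store.fn, h₂]) (by simp [Store.fn])))))
    ?_ (by simp only [List.length_reverse]; omega)
  rw [entry]
  funext j
  cases j <;> simp [Store.fn]

/-- Extracts the diagonal of the matrix on the stack `bits`. -/
def diagonal : Prog Stack (Option Bool) := each .u .t0 fun _ => diagonalEntry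

theorem exec_diagonal {n : ℕ} (f : Fin n → Fin n → Bool) (m : Store)
    (hu : m.u = List.replicate n (some true)) (h₁ : m.h1 = hot n 0) (h₂ : m.h2 = hot n 0)
    (hb : m.bits = (matrixBits f).map some) (ha : m.adj = []) :
    Exec R diagonal m.fn { m with
      h1 := hot n n, h2 := hot n n
      res := ((List.finRange n).map fun a => some (f a a)).reverse ++ m.res }.fn
      (n * (n * (10 * n + 6) + 2 * (n * n) + 8 * n + 18) + 2) := by
  have units : m.u = (List.finRange n).map fun _ => some true := by simp [hu]
  refine (exec_each (ξ := fun _ => some true) (l := List.finRange n)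
    (C := n * (10 * n + 6) + 2 * (n * n) + 8 * n + 14)
    (S := fun l₁ _ => { m with
      h1 := hot n l₁.length, h2 := hot n l₁.length
      res := (l₁.map fun a => some (f a a)).reverse ++ m.res }.fn)
    (by decide) ?_ (by simp) units rfl units rfl fun l₁ a l₂ hl x y => ?_).mono (by simp)
  · funext j
    cases j <;> simp [Store.fn, h₁, h₂]
  · have len := length_of_finRange_eq_append_cons hl
    refine (exec_diagonalEntry f a { m with
      h1 := hot n l₁.length, h2 := hot n l₁.length
      res := (l₁.map fun a => some (f a a)).reverse ++ m.res }
      (by rw [len]) (by rw [len]) hb ha x y).of_eq ?_ le_rfl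
    simp [len]

end Diagonal

section RowsAndColumns

/-- Decides for the vertex selected by the one-hot vector `h1` whether its column of the matrix on
the stack `bits` has an entry `true` or its row and the stack `h3` have a common one, and moves on
to the next vertex. -/
def rowAndColumn : Prog Stack (Option Bool) :=
  scan .h1 .t1 .h3 .t3 .bits .adj .acc ;; scan .h2 .t2 .h1 .t1 .bits .adj .acc ;;
    flush .acc .res ;; shift (some false) .h1 .t1

theorem exec_rowAndColumn {n : ℕ} (f : Fin n → Fin n → Bool) (d : Fin n → Bool) (v : Fin n)
    (m : Store) (h₁ : m.h1 = hot n v) (h₂ : m.h2 = List.replicate n (some true))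
    (h₃ : m.h3 = (List.finRange n).map fun a => some (d a))
    (hb : m.bits = (matrixBits f).map some) (ha : m.adj = []) (x y : List (Option Bool)) :
    Exec R rowAndColumn (update (update m.fn .u x) .t0 y)
      (update (update { m with
        h1 := hot n (v + 1)
        res := some (decide ((∃ a, f a v) ∨ ∃ b, f v b ∧ d b)) :: m.res }.fn .u x) .t0 y)
      (2 * (n * (10 * n + 6)) + 4 * (n * n) + 4 * n + 13) := by
  let δ : Fin n → Bool := fun j => decide (j.1 = v.1)
  let w : List (Option Bool) := (hits (fun _ => true) δ f).reverse ++ (hits δ d f).reverse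
  have hn : n ≠ 0 := v.pos.ne'
  have found : decide (w ≠ []) = decide ((∃ a, f a v) ∨ ∃ b, f v b ∧ d b) := by
    rw [decide_eq_decide, ne_eq, List.append_eq_nil_iff, not_and_or, ← ne_eq, ← ne_eq,
      List.reverse_ne_nil_iff, List.reverse_ne_nil_iff, hits_ne_nil, hits_ne_nil]
    simp [δ, ← Fin.ext_iff, and_comm]
  have len_column := length_hits_le (fun _ => true) δ f
  have len_row := length_hits_le δ d f
  refine Exec.of_eq ((exec_scan_matrix (ξ := δ) (η := d) (f := f) (by decide)
      (by simp [Store.fn, h₁, hot, δ]) (by simp [Store.fn]) (by simp [Store.fn, h₃])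
      (by simp [Store.fn]) (by simp [Store.fn, hb]) (by simp [Store.fn, ha])).seq
    ((exec_scan_matrix (ξ := fun _ => true) (η := δ) (f := f) (by decide)
      (by simp [Store.fn, h₂]) (by simp [Store.fn]) (by simp [Store.fn, h₁, hot, δ])
      (by simp [Store.fn]) (by simp [Store.fn, hb]) (by simp [Store.fn, ha])).seq
    ((exec_flush (z := w) (by decide) (by simp [Store.fn, w])).seq
    (exec_shift_hot (i := v) (by decide) hn (by simp [Store.fn, h₁]) (by simp [Store.fn])))))
    ?_ (by simp only [w, List.length_append, List.length_reverse]; omega)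
  rw [found]
  funext j
  cases j <;> simp [Store.fn]

/-- For each `v`, decides whether column `v` of the matrix on the stack `bits` has an entry `true`
or row `v` and the stack `h3` have a common one. -/
def rowsAndColumns : Prog Stack (Option Bool) := each .u .t0 fun _ => rowAndColumn

theorem exec_rowsAndColumns {n : ℕ} (f : Fin n → Fin n → Bool) (d : Fin n → Bool) (m : Store)
    (hu : m.u = List.replicate n (some true)) (h₁ : m.h1 = hot n 0)
    (h₂ : m.h2 = List.replicate n (some true))
    (h₃ : m.h3 = (List.finRange n).map fun a => some (d a))
    (hb : m.bits = (matrixBits f).map some) (ha : m.adj = []) :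
    Exec R rowsAndColumns m.fn { m with
      h1 := hot n n
      res := ((List.finRange n).map fun v =>
        some (decide ((∃ a, f a v) ∨ ∃ b, f v b ∧ d b))).reverse ++ m.res }.fn
      (n * (2 * (n * (10 * n + 6)) + 4 * (n * n) + 4 * n + 17) + 2) := by
  have units : m.u = (List.finRange n).map fun _ => some true := by simp [hu]
  refine (exec_each (ξ := fun _ => some true) (l := List.finRange n)
    (C := 2 * (n * (10 * n + 6)) + 4 * (n * n) + 4 * n + 13)
    (S := fun l₁ _ => { m with
      h1 := hot n l₁.length
      res := (l₁.map fun v =>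
        some (decide ((∃ a, f a v) ∨ ∃ b, f v b ∧ d b))).reverse ++ m.res }.fn)
    (by decide) (by simp [← h₁]) (by simp) units rfl units rfl fun l₁ v l₂ hl x y => ?_).mono
    (by simp)
  have len := length_of_finRange_eq_append_cons hl
  refine (exec_rowAndColumn f d v { m with
    h1 := hot n l₁.length
    res := (l₁.map fun v => some (decide ((∃ a, f a v) ∨ ∃ b, f v b ∧ d b))).reverse ++ m.res }
    (by rw [len]) h₂ h₃ hb ha x y).of_eq ?_ le_rfl
  simp [len]

end RowsAndColumns

section Pad

/-- Removes from the stack `uk` as many symbols as there are bits `true` on the stack `res`. -/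
def countChosen : Prog Stack (Option Bool) :=
  each .res .t0 fun x => if x = some true then .pop .uk else .skip

theorem exec_countChosen (l : List Bool) (k : ℕ) (m : Store) (hr : m.res = l.map some)
    (hk : m.uk = List.replicate k (some true)) :
    Exec R countChosen m.fn { m with uk := List.replicate (k - l.count true) (some true) }.fn
      (5 * l.length + 2) := by
  refine Exec.mono (exec_each (k := Stack.res) (t := .t0) (ξ := some) (l := l) (C := 1)
    (S := fun l₁ _ => { m with uk := List.replicate (k - l₁.count true) (some true) }.fn)
    (by decide) (by simp [← hk]) rfl hr rfl hr rfl ?_) (by omega)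
  rintro l₁ (_ | _) l₂ - x y
  · rw [if_neg (by decide)]
    refine Exec.of_eq Exec.skip ?_ le_rfl
    simp
  · rw [if_pos rfl]
    refine Exec.of_eq Exec.pop ?_ le_rfl
    funext j
    cases j <;> simp [Store.fn, Nat.sub_sub]

/-- Pads one bit. -/
def padBit (x : Option Bool) : Prog Stack (Option Bool) :=
  if x = some true then .push .adj (some true) else .branch .uk fun
    | none => .push .adj (some false)
    | some _ => .pop .uk ;; .push .adj (some true)

theorem exec_padBit (b : Bool) (r : ℕ) (m : Store) (hr : m.uk = List.replicate r (some true)) :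
    Exec R (padBit (some b)) m.fn { m with
      uk := List.replicate (r - [b].count false) (some true)
      adj := (padBits r [b]).map some ++ m.adj }.fn 3 := by
  cases b with
  | true =>
    refine Exec.of_eq Exec.push ?_ (by omega)
    funext j
    cases j <;> simp [Store.fn, hr, padBits]
  | false =>
    refine Exec.branch (t := 2) ?_
    rw [show m.fn .uk = _ from hr]
    cases r with
    | zero =>
      refine Exec.of_eq Exec.push ?_ one_le_two
      funext j
      cases j <;> simp [Store.fn, hr, padBits]
    | succ r =>
      refine (Exec.pop.seq Exec.push).of_eq ?_ le_rfl
      funext j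
      cases j <;> simp [Store.fn, hr, padBits]

theorem padBits_append (r : ℕ) (l l' : List Bool) :
    padBits r (l ++ l') = padBits r l ++ padBits (r - l.count false) l' := by
  fun_induction padBits r l <;> simp_all [padBits]

/-- Pads the bits on the stack `bits`. -/
def pad : Prog Stack (Option Bool) := .loop .bits padBit

theorem exec_pad (l : List Bool) (r : ℕ) (m : Store) (hb : m.bits = l.map some)
    (hr : m.uk = List.replicate r (some true)) :
    Exec R pad m.fn { m with
      bits := []
      uk := List.replicate (r - l.count false) (some true)
      adj := ((padBits r l).map some).reverse ++ m.adj }.fn (4 * l.length + 1) := by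
  have loop := exec_loop (R := R) (k := Stack.bits) (l := l) (C := 3) (body := padBit)
    (S := fun l₁ l₂ => { m with
      bits := l₂.map some
      uk := List.replicate (r - l₁.count false) (some true)
      adj := ((padBits r l₁).map some).reverse ++ m.adj }.fn) rfl ?_
  · exact (loop.of_start_eq (by simp [← hb, ← hr, padBits])).mono (by omega)
  intro l₁ b l₂ _
  have step := exec_padBit (R := R) b (r - l₁.count false) { m with
    bits := l₂.map some
    uk := List.replicate (r - l₁.count false) (some true)
    adj := ((padBits r l₁).map some).reverse ++ m.adj } rfl
  refine ⟨some b, l₂.map some, rfl, (step.of_start_eq ?_).of_eq ?_ le_rfl⟩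
  · funext j
    cases j <;> simp [Store.fn]
  · have len_step : (padBits (r - l₁.count false) [b]).length = 1 := length_padBits _ _
    obtain ⟨c, hc⟩ := List.length_eq_one_iff.1 len_step
    simp [padBits_append, hc, Nat.sub_sub]

/-- Writes the bits on the stack `adj`. -/
def writeBits : Prog Stack (Option Bool) :=
  .loop .adj fun x => .push .out none ;; if x = some true then .push .out (some true) else .skip

theorem exec_writeBits (l : List Bool) (m : Store) (h : m.adj = l.map some) :
    Exec R writeBits m.fn { m with
      adj := [], out := l.reverse.flatMap bitCode ++ m.out }.fn (3 * l.length + 1) := by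
  have loop := exec_loop (R := R) (k := Stack.adj) (l := l) (C := 2)
    (body := fun x => .push .out none ;;
      if x = some true then .push .out (some true) else .skip)
    (S := fun l₁ l₂ => { m with
      adj := l₂.map some, out := l₁.reverse.flatMap bitCode ++ m.out }.fn) rfl ?_
  · exact (loop.of_start_eq (by simp [← h])).mono (by omega)
  rintro l₁ (_ | _) l₂ -
  · refine ⟨some false, l₂.map some, rfl, ?_⟩
    rw [if_neg (by decide)]
    refine (Exec.push.seq Exec.skip).of_eq ?_ le_rfl
    funext j
    cases j <;> simp [Store.fn, bitCode]
  · refine ⟨some true, l₂.map some, rfl, ?_⟩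
    rw [if_pos rfl]
    refine (Exec.push.seq Exec.push).of_eq ?_ le_rfl
    funext j
    cases j <;> simp [Store.fn, bitCode]

end Pad

end ElectionControl

namespace ElectionControl

open StackProgram Computability Function

variable {R : List (Option Bool) → List (Option Bool) → ℕ → Prop}

section DecodePlan

theorem SeedPlan.IsSingleNews.length_encodeNat_le {ℓ n : ℕ} {P : SeedPlan ℓ n}
    (hP : P.IsSingleNews) {s : Fin n} {μ : Fin (ℓ + 1) → ℤ} (hs : P s = some μ) (i : Fin (ℓ + 1)) :
    (encodeNat (Equiv.intEquivNat (μ i))).length ≤ 2 := by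
  obtain ⟨j, q, hq, h⟩ := hP
  refine (StackProgram.length_encodeNat_le _).trans ?_
  rw [h s μ hs, Pi.single_apply]
  rcases hq with rfl | rfl <;> split_ifs <;> decide

theorem length_encodeSeedPlan_le {n : ℕ} {P : SeedPlan 1 n} (hP : P.IsSingleNews) :
    (encodeSeedPlan ⟨n, P⟩).length ≤ 9 * n + 1 := by
  have len_n := StackProgram.length_encodeNat_le n
  have seed (s : Fin n) : (seedCode (P s)).length ≤ 8 := by
    cases hs : P s with
    | none => simp [seedCode]
    | some μ =>
      have len₀ := hP.length_encodeNat_le hs 0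
      have len₁ := hP.length_encodeNat_le hs 1
      simp only [Fin.isValue, seedCode, List.finRange_succ, List.finRange_zero, encodeNats_cons,
        encodeNats_nil] at len₀ len₁ ⊢
      simp only [List.map_cons, List.map_nil, List.flatMap_cons, List.flatMap_nil, List.append_nil,
        List.length_cons, List.length_append, List.length_map, List.length_nil,
        Fin.succ_zero_eq_one]
      omega
  have seeds := length_flatMap_le fun s (_ : s ∈ List.finRange n) => seed s
  rw [List.length_finRange] at seeds
  rw [encodeSeedPlan_eq]
  simp only [List.length_append, List.length_map, List.length_cons]
  omega

/-- The seeds of a plan for the election of the reduction, as a matrix: its voters are the pairs of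
vertices. -/
def seedMatrix {n : ℕ} (P : SeedPlan 1 (n * n)) (a b : Fin n) : Bool :=
  (P (finProdFinEquiv (a, b))).isSome

theorem map_isSome_map_finRange {n : ℕ} (P : SeedPlan 1 (n * n)) :
    ((List.finRange (n * n)).map P).map (fun o => some o.isSome) =
      (matrixBits (seedMatrix P)).map some := by
  simp only [matrixBits, seedMatrix, List.map_eq_flatMap, flatMap_finRange_mul_self,
    List.flatMap_assoc, List.flatMap_cons, List.flatMap_nil, List.append_nil]

/-- Turns the code of a seed plan on the stack `res` into the matrix of its seeds on the stack
`bits`. -/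
def decodePlan : Prog Stack (Option Bool) :=
  move .res .inp ;; skipNum ;; readPlan ;; move .adj .bits

theorem exec_decodePlan {n : ℕ} {P : SeedPlan 1 (n * n)} (hP : P.IsSingleNews) (m : Store)
    (hr : m.res = (encodeSeedPlan ⟨n * n, P⟩).reverse) (hi : m.inp = [])
    (ha : m.adj = []) (hb : m.bits = []) :
    Exec R decodePlan m.fn
      { m with res := [], bits := (matrixBits (seedMatrix P)).map some }.fn
      (2 * (9 * (n * n) + 1) + 1 + (7 * (n * n) + 6 + (43 * (n * n) + 1 +
        (2 * (n * n) + 1)))) := by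
  have plan_eq : encodeSeedPlan ⟨n * n, P⟩ =
      (encodeNat (n * n)).map some ++ none :: ((List.finRange (n * n)).map P).flatMap seedCode := by
    rw [encodeSeedPlan_eq, List.flatMap_map]
  have len_plan := length_encodeSeedPlan_le hP
  have len_N := length_encodeNat_le (n * n)
  have fetch := (exec_move (R := R) (a := Stack.res) (b := .inp) (s := m.fn) (by decide) hr).mono
    (t' := 2 * (9 * (n * n) + 1) + 1) (by simpa using len_plan)
  have skip := exec_skipNum (R := R) _ _
    { m with res := [], inp := encodeSeedPlan ⟨n * n, P⟩ } plan_eq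
  have read := exec_readPlan (R := R) ((List.finRange (n * n)).map P)
    { m with res := [], inp := ((List.finRange (n * n)).map P).flatMap seedCode } rfl fun μ hμ => by
      obtain ⟨s, -, hs⟩ := List.mem_map.1 hμ
      exact hP.length_encodeNat_le hs
  rw [map_isSome_map_finRange] at read
  have store := exec_move (R := R) (a := Stack.adj) (b := .bits)
    (x := ((matrixBits (seedMatrix P)).map some).reverse)
    (s := { m with res := [], inp := [], adj := ((matrixBits (seedMatrix P)).map some).reverse }.fn)
    (by decide) rfl
  refine (fetch.seq ((skip.of_start_eq ?_).seq (read.seq (store.of_start_eq ?_)))).of_eq ?_ ?_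
  · funext j
    cases j <;> simp [Store.fn, hi]
  · simp [ha]
  · funext j
    cases j <;> simp [Store.fn, hi, ha, hb]
  · simp only [List.length_reverse, List.length_map, length_matrixBits,
      List.length_finRange]
    omega

end DecodePlan

section MarkChosen

variable {n : ℕ} {f : Fin n → Fin n → Bool}

/-- Writes the diagonal of the matrix on the stack `bits` to the stack `h3`. -/
def markDiagonal : Prog Stack (Option Bool) :=
  initHot .u .t0 .h1 ;; initHot .u .t0 .h2 ;; diagonal ;; move .res .h3 ;; clear .h1 ;; clear .h2

theorem exec_initHot_u {h : Stack} {s : Stack → List (Option Bool)} (hh : h ∉ [.u, .t0])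
    (hu : s .u = List.replicate n (some true)) (ht : s .t0 = []) (hs : s h = []) :
    Exec R (initHot .u .t0 h) s (update s h (hot n 0)) (5 * n + 5) :=
  exec_initHot (by decide) (by grind) (by grind) hu ht hs

theorem exec_clear_of_length_le {h : Stack} {s : Stack → List (Option Bool)}
    (hs : (s h).length ≤ n) : Exec R (clear h) s (update s h []) (2 * n + 1) :=
  (exec_clear rfl).mono (by omega)

theorem exec_markDiagonal (m : Store) (hu : m.u = List.replicate n (some true))
    (hb : m.bits = (matrixBits f).map some) (h₁ : m.h1 = []) (h₂ : m.h2 = []) (h₃ : m.h3 = [])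
    (ha : m.adj = []) (hr : m.res = []) :
    Exec R markDiagonal m.fn
      { m with h3 := (List.finRange n).map fun a => some (f a a) }.fn
      (5 * n + 5 + (5 * n + 5 + (n * (n * (10 * n + 6) + 2 * (n * n) + 8 * n + 18) + 2 +
        (2 * n + 1 + (2 * n + 1 + (2 * n + 1)))))) := by
  let d : List (Option Bool) := (List.finRange n).map fun a => some (f a a)
  have extract := exec_diagonal (R := R) f { m with h1 := hot n 0, h2 := hot n 0 } hu rfl rfl hb ha
  have store := (exec_move (R := R) (a := Stack.res) (b := .h3) (x := d.reverse)
    (s := { m with h1 := hot n n, h2 := hot n n, res := d.reverse }.fn) (by decide) rfl).mono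
      (t' := 2 * n + 1) (by simp [d])
  refine Exec.of_eq ((exec_initHot_u (by decide) hu rfl h₁).seq
    ((exec_initHot_u (by decide) (by simpa [Store.fn] using hu) (by simp [Store.fn])
      (by simpa [Store.fn] using h₂)).seq ((extract.of_start_eq ?_).seq ((store.of_start_eq ?_).seq
    ((exec_clear_of_length_le (n := n) (by simp [Store.fn])).seq
    (exec_clear_of_length_le (n := n) (by simp [Store.fn]))))))) ?_ le_rfl
  · funext j
    cases j <;> simp [Store.fn]
  · simp [hr, d]
  · funext j
    cases j <;> simp [Store.fn, h₁, h₂, h₃, hr, d]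

/-- Leaves the characteristic vector of the chosen vertices on the stack `res`. -/
def markChosen : Prog Stack (Option Bool) :=
  initHot .u .t0 .h1 ;; each .u .t0 (fun _ => .push .h2 (some true)) ;; rowsAndColumns ;;
    clear .bits

theorem exec_markChosen {d : Fin n → Bool} (m : Store) (hu : m.u = List.replicate n (some true))
    (hb : m.bits = (matrixBits f).map some) (h₁ : m.h1 = []) (h₂ : m.h2 = [])
    (h₃ : m.h3 = (List.finRange n).map fun a => some (d a)) (ha : m.adj = []) (hr : m.res = []) :
    Exec R markChosen m.fn
      { m with
        h1 := hot n n, h2 := List.replicate n (some true), bits := []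
        res := ((List.finRange n).map fun v =>
          some (decide ((∃ a, f a v) ∨ ∃ b, f v b ∧ d b))).reverse }.fn
      (5 * n + 5 + (n * 5 + 2 + (n * (2 * (n * (10 * n + 6)) + 4 * (n * n) + 4 * n + 17) + 2 +
        (2 * (n * n) + 1)))) := by
  have fill := exec_each_push (R := R) (k := Stack.u) (t := .t0) (o := .h2)
    (g := fun _ => some true) (x := List.replicate n (some true))
    (s := { m with h1 := hot n 0 }.fn) (by decide) (by decide) (by decide) hu rfl
  have mark := exec_rowsAndColumns (R := R) f d
    { m with h1 := hot n 0, h2 := List.replicate n (some true) } hu rfl rfl h₃ hb ha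
  refine Exec.of_eq ((exec_initHot_u (by decide) hu rfl h₁).seq ((fill.of_start_eq ?_).seq
    ((mark.of_start_eq ?_).seq (exec_clear hb)))) ?_ (by simp)
  · funext j
    cases j <;> simp [Store.fn]
  · funext j
    cases j <;> simp [Store.fn, h₂]
  · funext j
    cases j <;> simp [Store.fn, hr]

end MarkChosen

section WriteSet

/-- Pads the vector on the stack `res` and writes its bits. -/
def padChosen : Prog Stack (Option Bool) := countChosen ;; move .res .bits ;; pad ;; writeBits

theorem exec_padChosen (l : List Bool) (k : ℕ) (m : Store) (hr : m.res = (l.map some).reverse)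
    (hk : m.uk = List.replicate k (some true)) (hb : m.bits = []) (ha : m.adj = []) :
    Exec R padChosen m.fn
      { m with
        res := []
        uk := List.replicate (k - l.count true - l.count false) (some true)
        out := (padBits (k - l.count true) l).flatMap bitCode ++ m.out }.fn
      (5 * l.length + 2 + (2 * l.length + 1 + (4 * l.length + 1 + (3 * l.length + 1)))) := by
  let r : ℕ := k - l.count true
  have count := exec_countChosen (R := R) l.reverse k m (by simpa using hr) hk
  rw [List.count_reverse] at count
  have fetch := exec_move (R := R) (a := Stack.res) (b := .bits) (x := (l.map some).reverse)
    (s := { m with uk := List.replicate r (some true) }.fn) (by decide) hr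
  have padding := exec_pad (R := R) l r
    { m with uk := List.replicate r (some true), res := [], bits := l.map some } rfl rfl
  have write := exec_writeBits (R := R) (padBits r l).reverse
    { m with
      uk := List.replicate (r - l.count false) (some true), res := []
      adj := ((padBits r l).map some).reverse } (by simp)
  refine (count.seq (fetch.seq ((padding.of_start_eq ?_).seq (write.of_start_eq ?_)))).of_eq ?_
    (by simp)
  · funext j
    cases j <;> simp [Store.fn, hb]
  · simp [ha, hb]
  · simp [ha, r]

/-- Completes the code of the set of vertices and discards the remaining stacks. -/
def finish : Prog Stack (Option Bool) :=
  .push .out none ;; move .nR .out ;; clear .u ;; clear .uk ;; clear .h1 ;; clear .h2 ;; clear .h3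

theorem exec_finish {n : ℕ} (m : Store) (hn : m.nR.length ≤ n) (hu : m.u.length ≤ n)
    (huk : m.uk.length ≤ n) (h₁ : m.h1.length ≤ n) (h₂ : m.h2.length ≤ n)
    (h₃ : m.h3.length ≤ n) :
    Exec R finish m.fn
      { m with
        nR := [], u := [], uk := [], h1 := [], h2 := [], h3 := []
        out := m.nR.reverse ++ none :: m.out }.fn
      (1 + (2 * n + 1 + (2 * n + 1 + (2 * n + 1 + (2 * n + 1 + (2 * n + 1 + (2 * n + 1))))))) := by
  have write := (exec_move (R := R) (a := Stack.nR) (b := .out) (x := m.nR)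
    (s := { m with out := none :: m.out }.fn) (by decide) rfl).mono (t' := 2 * n + 1) (by omega)
  refine Exec.of_eq (Exec.push.seq ((write.of_start_eq ?_).seq
    ((exec_clear_of_length_le ?_).seq ((exec_clear_of_length_le ?_).seq
    ((exec_clear_of_length_le ?_).seq ((exec_clear_of_length_le ?_).seq
    (exec_clear_of_length_le ?_))))))) ?_ le_rfl
  · funext j
    cases j <;> simp [Store.fn]
  any_goals simpa [Store.fn]
  funext j
  cases j <;> simp [Store.fn]

end WriteSet

section ExtractionProg

/-- Turns the code of a seed plan on the stack `res` into the code of a set of vertices on the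
stack `out`. -/
def extractionProg : Prog Stack (Option Bool) :=
  decodePlan ;; markDiagonal ;; markChosen ;; padChosen ;; finish

/-- The running time of `extractionProg`, in any semiring as for `reductionTime`. -/
def extractionTime {A : Type*} [CommSemiring A] (n : A) : A :=
  2 * (9 * (n * n) + 1) + 1 + (7 * (n * n) + 6 + (43 * (n * n) + 1 + (2 * (n * n) + 1))) +
  (5 * n + 5 + (5 * n + 5 + (n * (n * (10 * n + 6) + 2 * (n * n) + 8 * n + 18) + 2 +
    (2 * n + 1 + (2 * n + 1 + (2 * n + 1))))) +
  (5 * n + 5 + (n * 5 + 2 + (n * (2 * (n * (10 * n + 6)) + 4 * (n * n) + 4 * n + 17) + 2 +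
    (2 * (n * n) + 1))) +
  (5 * n + 2 + (2 * n + 1 + (4 * n + 1 + (3 * n + 1))) +
  (1 + (2 * n + 1 + (2 * n + 1 + (2 * n + 1 + (2 * n + 1 + (2 * n + 1 + (2 * n + 1))))))))))

variable {I : DkSInstance}

theorem map_some_chosenBits (P : SeedPlan 1 (reduction I).n) :
    ((List.finRange I.n).map fun v => some (decide ((∃ a, seedMatrix P a v) ∨
      ∃ b, seedMatrix P v b ∧ seedMatrix P b b))) = (chosenBits P).map some := by
  rw [chosenBits, List.map_map]
  refine List.map_congr_left fun v _ => ?_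
  simp only [comp_apply, Option.some_inj, decide_eq_decide, mem_chosen, SeedPlan.mem_seeds]
  rfl

theorem exec_extractionProg {P : SeedPlan 1 (reduction I).n} (hP : P.IsSingleNews) :
    Exec R extractionProg
      { nR := ((encodeNat I.n).map some).reverse
        u := List.replicate I.n (some true)
        uk := List.replicate I.k (some true)
        res := (encodeSeedPlan ⟨(reduction I).n, P⟩).reverse : Store }.fn
      { out := encodeVertexSet ⟨I.n, finalSet P⟩ : Store }.fn (extractionTime I.n) := by
  let base : Store :=
    { nR := ((encodeNat I.n).map some).reverse
      u := List.replicate I.n (some true), uk := List.replicate I.k (some true) }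
  let withDiagonal : Store :=
    { base with h3 := (List.finRange I.n).map fun a => some (seedMatrix P a a) }
  let marked : Store :=
    { withDiagonal with
      h1 := hot I.n I.n, h2 := List.replicate I.n (some true)
      res := ((chosenBits P).map some).reverse }
  have len_chosen : (chosenBits P).length = I.n := by simp [chosenBits]
  have hk := I.k_le
  have decode := exec_decodePlan (R := R) hP
    { base with res := (encodeSeedPlan ⟨(reduction I).n, P⟩).reverse } rfl rfl rfl rfl
  have diagonal := exec_markDiagonal (R := R)
    { base with bits := (matrixBits (seedMatrix P)).map some } rfl rfl rfl rfl rfl rfl rfl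
  have mark := exec_markChosen (R := R) (d := fun a => seedMatrix P a a)
    { withDiagonal with bits := (matrixBits (seedMatrix P)).map some } rfl rfl rfl rfl rfl rfl rfl
  rw [map_some_chosenBits] at mark
  have padding := exec_padChosen (R := R) (chosenBits P) I.k marked rfl rfl rfl rfl
  rw [len_chosen] at padding
  have complete := exec_finish (R := R) (n := I.n)
    { marked with
      res := []
      uk := List.replicate (I.k - (chosenBits P).count true - (chosenBits P).count false)
        (some true)
      out := (finalBits P).flatMap bitCode ++ [] }
    (by simpa [marked, withDiagonal, base] using length_encodeNat_le I.n)
    (by simp [marked, withDiagonal, base]) (by simp; omega) (by simp [marked])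
    (by simp [marked]) (by simp [marked, withDiagonal])
  refine (decode.seq (diagonal.seq (mark.seq (padding.seq complete)))).of_eq ?_ le_rfl
  simp [marked, withDiagonal, base, encodeVertexSet_finalSet]

end ExtractionProg

end ElectionControl

namespace ElectionControl

open StackProgram Computability Function Turing Polynomial

/-! ### The approximation algorithm -/

section RunningTime

theorem eval_le_eval_of_le (p : ℕ[X]) {a b : ℕ} (h : a ≤ b) : p.eval a ≤ p.eval b := by
  rw [eval_eq_sum_range, eval_eq_sum_range]
  gcongr

/-- A bound on the length of the code of an election that comes from a graph with `n` vertices, in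
any semiring as for `reductionTime`. -/
def codeLength {A : Type*} [CommSemiring A] (n : A) : A :=
  n * n + 1 + (n + 1 + (n * (n * (n * (n * 6))) + n * n * 4))

theorem length_networkCode_le (n : ℕ) : (networkCode n).length ≤ n * (n * (n * (n * 6))) := by
  have rows (a : Fin n) : (rowsCode a).length ≤ n * (n * (n * 6)) := by
    refine (length_flatMap_le (C := n * (n * 6)) fun b _ => ?_).trans (by simp)
    refine (length_flatMap_le (C := n * 6) fun c _ => ?_).trans (by simp)
    exact (length_flatMap_le fun d _ => length_edgeCode_le _).trans (by simp)
  exact (length_flatMap_le fun a _ => rows a).trans (by simp)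

theorem length_encodeECSInstance_reduction_le (I : DkSInstance) :
    (encodeECSInstance (reduction I)).length ≤ codeLength I.n := by
  have len_voters := length_encodeNat_le (I.n * I.n)
  have len_budget := (length_encodeNat_le I.k).trans I.k_le
  have len_network := length_networkCode_le I.n
  have len_scores := length_flatMap_le fun b (_ : b ∈ adjBits I) => length_scoreCode_le b
  rw [length_adjBits] at len_scores
  rw [encodeECSInstance_reduction]
  simp only [List.length_append, List.length_cons, List.length_map, codeLength]
  omega

theorem le_length_encodeDkSInstance (I : DkSInstance) : I.n ≤ (encodeDkSInstance I).length := by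
  have len_graph : I.n * I.n ≤ ((adjBits I).flatMap bitCode).length := by
    rw [List.length_flatMap, ← length_adjBits]
    refine le_trans (by simp) (List.card_nsmul_le_sum _ 1 fun len h => ?_)
    obtain ⟨b, -, rfl⟩ := List.mem_map.1 h
    cases b <;> simp [bitCode]
  have le_sq := Nat.le_mul_self I.n
  rw [encodeDkSInstance_eq]
  simp only [List.length_append, List.length_cons]
  omega

end RunningTime

section Algorithm

/-- The algorithm for Densest-`k`-Subgraph that calls an algorithm for elections once. -/
def algorithm : Prog Stack (Option Bool) := reductionProg ;; .call .out .res ;; extractionProg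

/-- The running time of `algorithm` in terms of the number of vertices, if the polynomial `p` bounds
the running time of the algorithm for elections. -/
noncomputable def algorithmTime (p : ℕ[X]) : ℕ[X] :=
  reductionTime X +
    (codeLength X + p.comp (codeLength X) + (9 * (X * X) + 1) + 2 + extractionTime X)

theorem eval_algorithmTime (p : ℕ[X]) (n : ℕ) :
    (algorithmTime p).eval n = reductionTime n +
      (codeLength n + p.eval (codeLength n) + (9 * (n * n) + 1) + 2 + extractionTime n) := by
  simp [algorithmTime, reductionTime, extractionTime, codeLength]

theorem exec_algorithm {R : List (Option Bool) → List (Option Bool) → ℕ → Prop} (I : DkSInstance)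
    {P : SeedPlan 1 (reduction I).n} (hP : P.IsSingleNews) {p : ℕ[X]}
    (hR : R (encodeECSInstance (reduction I)) (encodeSeedPlan ⟨(reduction I).n, P⟩)
      (p.eval (encodeECSInstance (reduction I)).length)) :
    Exec R algorithm (update (fun _ => []) .inp (encodeDkSInstance I))
      (update (fun _ => []) .out (encodeVertexSet ⟨I.n, finalSet P⟩))
      ((algorithmTime p).eval (encodeDkSInstance I).length) := by
  have len_election := length_encodeECSInstance_reduction_le I
  have len_plan : (encodeSeedPlan ⟨(reduction I).n, P⟩).length ≤ 9 * (I.n * I.n) + 1 :=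
    length_encodeSeedPlan_le hP
  have call_time := eval_le_eval_of_le p len_election
  have time_le := eval_le_eval_of_le (algorithmTime p) (le_length_encodeDkSInstance I)
  rw [eval_algorithmTime] at time_le
  refine (((exec_reductionProg I).seq ((Exec.call (i := Stack.out) (o := .res) hR rfl).seq
    ((exec_extractionProg hP).of_start_eq ?_))).of_eq ?_ (by omega)).of_start_eq ?_
  all_goals
    funext j
    cases j <;> simp [Store.fn]

/-- The machine of `algorithm`, where `M` is the machine called by it. -/
noncomputable def polyTimeAlgorithm {A : (I : ECSInstance 1) → SeedPlan 1 I.n}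
    (hA : ∀ I, (A I).IsSingleNews)
    (M : TM2ComputableInPolyTime encodeECSInstance encodeSeedPlan
      fun I : ECSInstance 1 => (⟨I.n, A I⟩ : Σ n, SeedPlan 1 n)) :
    TM2ComputableInPolyTime encodeDkSInstance encodeVertexSet
      fun I : DkSInstance => (⟨I.n, finalSet (A (reduction I))⟩ : Σ n, Finset (Fin n)) where
  tm := machine M.tm M.inputAlphabet M.outputAlphabet algorithm .inp .out
  inputAlphabet := Equiv.refl (Option Bool)
  outputAlphabet := Equiv.refl (Option Bool)
  time := algorithmTime M.time + 1
  outputsFun I := by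
    have run := (exec_algorithm I (hA _) ⟨M.outputsFun (reduction I)⟩).machine_outputs.some
    rw [eval_add, eval_one]
    have map_refl (l : List (Option Bool)) : l = l.map (Equiv.refl (Option Bool)).invFun :=
      (List.map_id l).symm
    exact cast (congrArg₂ (fun x y => TM2OutputsInTime
      (machine M.tm M.inputAlphabet M.outputAlphabet algorithm .inp .out) x (some y) _)
      (map_refl _) (map_refl _)) run

theorem dkSApproximable_of_ecsSingleNewsApproximable {ρ : ℝ} (hρ : 0 < ρ)
    (h : ECSSingleNewsApproximable 1 ρ) : DkSApproximable ρ := by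
  obtain ⟨A, hA, ⟨M⟩⟩ := h
  exact ⟨fun I => finalSet (A (reduction I)),
    fun I => ⟨card_finalSet (hA _).1,
      fun X hX => mul_density_le_density_finalSet hρ (hA _).1 (hA _).2 hX⟩,
    ⟨polyTimeAlgorithm (fun I => (hA I).1.1) M⟩⟩

end Algorithm

end ElectionControl

theorem theorem4 :
    (∀ ρ : ℝ, 0 < ρ → ElectionControl.ECSSingleNewsApproximable 1 ρ →
      ElectionControl.DkSApproximable ρ) ∧
    ((¬ ∃ ρ : ℝ, 0 < ρ ∧ ElectionControl.DkSApproximable ρ) →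
      ¬ ∃ ρ : ℝ, 0 < ρ ∧ ElectionControl.ECSSingleNewsApproximable 1 ρ) := by
  refine ⟨fun ρ hρ => ElectionControl.dkSApproximable_of_ecsSingleNewsApproximable hρ, ?_⟩
  rintro not_dkS ⟨ρ, hρ, hECS⟩
  exact not_dkS ⟨ρ, hρ, ElectionControl.dkSApproximable_of_ecsSingleNewsApproximable hρ hECS⟩
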